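/- Let $\zeta_k=e^{2\pi i/k}$, let $\mathfrak f(\tau)=\zeta_{48}^{-1}\eta(\frac{\tau+1}2)/\eta(\tau)$, $\mathfrak f_1(\tau)=\eta(\frac{\tau}2)/\eta(\tau)$, $\mathfrak f_2(\tau)=\sqrt2\,\eta(2\tau)/\eta(\tau)$ be the Weber functions, and put $(\mathfrak u_0,\mathfrak u_1,\mathfrak u_2)=(\mathfrak f,\zeta_{16}\mathfrak f_1,\zeta_{16}^{-1}\mathfrak f_2)$. For $N\mid 24$ let $\Gamma_N\subseteq\mathrm{PSL}_2(\mathbb Z)$ be the subgroup of elements that fix each of the functions $\mathfrak u_0^{24/N},\mathfrak u_1^{24/N},\mathfrak u_2^{24/N}$. Let $K$ be a field with an embedding into $\mathbb C$ that contains $\sqrt2$ and a primitive $24$-th root of unity, and let $\mu_m\subset K^\times$ be the group of $m$-th roots of unity. The Weber curve $\mathcal W_N\subset\mathbb P^3_K$ is defined, for $N=3n$ with $n\mid 8$, by $$X_0^n+X_1^n+X_2^n=0,\qquad X_0X_1X_2=\sqrt2^{\,8/n}X_3^3,$$ and, for $N=n$ with $n\mid 8$, by $$X_0^n+X_1^n+X_2^n=48X_3^n,\qquad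 X_0X_1X_2=\sqrt8^{\,8/n}X_3^3.$$ For $mn\mid 24$ let $\pi:\mathcal W_{mn}\to\mathcal W_n$ be the morphism $(X_0:X_1:X_2:X_3)\mapsto(X_0^m:X_1^m:X_2^m:X_3^m)$. The group $\mu_m^3$ acts on $\mathbb P^3$ by $(h_0,h_1,h_2)\cdot(X_0:X_1:X_2:X_3)=(h_0X_0:h_1X_1:h_2X_2:X_3)$. **Proposition.** Let $mn\mid 24$. The curves $\mathcal W_{mn}$ and $\mathcal W_n$ are integral, $\pi$ maps $\mathcal W_{mn}(K)$ into $\mathcal W_n(K)$ (onto it if $K$ is algebraically closed) and is dominant, and there is a subgroup $H\subseteq\mu_m^3$, acting on $\mathcal W_{mn}$ by automorphisms over $\mathcal W_n$, such that $\pi$ is the quotient by $H$ in the sense of covers of curves: the extension of function fields $K(\mathcal W_{mn})/\pi^*K(\mathcal W_n)$ is Galois, its automorphism group is $H$ (acting by $X_i/X_3\mapsto h_iX_i/X_3$), and $\pi^*K(\mathcal W_n)=K(\mathcal W_{mn})^H$. Moreover any two $K$-rational points of $\mathcal W_{mn}$ with the same image, a nonsingular point of $\mathcal W_n$, lie in one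 $H$-orbit. Furthermore $\Gamma_{mn}\subseteq\Gamma_n$, $\Gamma_{mn}$ is normal in $\Gamma_n$, and there is an isomorphism $\Gamma_n/\Gamma_{mn}\cong H$, $\gamma\mapsto h$, given by $\mathfrak u_i^{24/(mn)}\circ\gamma=h_i\,\mathfrak u_i^{24/(mn)}$ for $i=0,1,2$. * If $m=3$, then $H=\Delta(\mu_3)=\{(a,a,a):a\in\mu_3\}$. * If $m\mid 8$, then $H=\nabla(\mu_m^2)=\{(a,b,(ab)^{-1}):a,b\in\mu_m\}$. Hence $\pi$ has degree $[K(\mathcal W_{mn}):\pi^*K(\mathcal W_n)]=3$ if $m=3$, and $m^2$ if $m\mid 8$. -/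

import Mathlib

open MvPolynomial
open scoped UpperHalfPlane MatrixGroups LinearAlgebra.Projectivization

namespace Weber

noncomputable section

/-! ### Weber functions and the groups `Γ_N` -/

/-- The standard primitive `k`-th root of unity `exp (2πi / k)`. -/
def zeta (k : ℕ) : ℂ := Complex.exp (2 * Real.pi * Complex.I / k)

/-- The classical Weber function `𝔣`. -/
def weberF (τ : ℍ) : ℂ :=
  (zeta 48)⁻¹ * ModularForm.eta (((τ : ℂ) + 1) / 2) / ModularForm.eta (τ : ℂ)

/-- The classical Weber function `𝔣₁`. -/
def weberF₁ (τ : ℍ) : ℂ :=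
  ModularForm.eta ((τ : ℂ) / 2) / ModularForm.eta (τ : ℂ)

/-- The classical Weber function `𝔣₂`. -/
def weberF₂ (τ : ℍ) : ℂ :=
  (Real.sqrt 2 : ℂ) * ModularForm.eta (2 * (τ : ℂ)) / ModularForm.eta (τ : ℂ)

/-- The normalized Weber functions `(𝔲₀, 𝔲₁, 𝔲₂) = (𝔣, ζ₁₆ 𝔣₁, ζ₁₆⁻¹ 𝔣₂)`. -/
def weberU : Fin 3 → ℍ → ℂ :=
  ![weberF, fun τ => zeta 16 * weberF₁ τ, fun τ => (zeta 16)⁻¹ * weberF₂ τ]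

/-- The matrices in `SL₂(ℤ)` acting trivially, through Möbius transformations, on the triple
of functions `(𝔲₀^(24/N), 𝔲₁^(24/N), 𝔲₂^(24/N))`. -/
def weberKernelSL (N : ℕ) : Subgroup SL(2, ℤ) where
  carrier := {γ | ∀ (i : Fin 3) (τ : ℍ), weberU i (γ • τ) ^ (24 / N) = weberU i τ ^ (24 / N)}
  one_mem' := by intro i τ; simp
  mul_mem' := by
    intro a b ha hb i τ
    rw [mul_smul, ha i, hb i]
  inv_mem' := by
    intro a ha i τ
    have h := ha i (a⁻¹ • τ)
    rw [smul_inv_smul] at h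
    exact h.symm

/-- `Γ_N`: the kernel of the action of `PSL₂(ℤ)` on the triple of functions
`(𝔲₀^(24/N), 𝔲₁^(24/N), 𝔲₂^(24/N))`. -/
def weberGamma (N : ℕ) : Subgroup (Matrix.ProjectiveSpecialLinearGroup (Fin 2) ℤ) :=
  (weberKernelSL N).map (QuotientGroup.mk' (Subgroup.center SL(2, ℤ)))

/-! ### Weber curves

Throughout, `r` is a square root of `2` in the base field `K`. -/

section Curves

variable {K : Type*} [Field K]

/-- The first form defining the Weber curve `W_N` in `ℙ³`, for `N ∣ 24`: with `n = N / 3` it is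
`X₀ⁿ + X₁ⁿ + X₂ⁿ` if `3 ∣ N`, and it is `X₀ᴺ + X₁ᴺ + X₂ᴺ - 48 X₃ᴺ` otherwise. -/
def weberForm₁ (K : Type*) [Field K] (N : ℕ) : MvPolynomial (Fin 4) K :=
  if 3 ∣ N then X 0 ^ (N / 3) + X 1 ^ (N / 3) + X 2 ^ (N / 3)
  else X 0 ^ N + X 1 ^ N + X 2 ^ N - C 48 * X 3 ^ N

/-- The constant `X₀X₁X₂ / X₃³` on the Weber curve `W_N`, for `N ∣ 24`:
`√2 ^ m` with `m * (N / 3) = 8` if `3 ∣ N`, and `√8 ^ m` with `m * N = 8` otherwise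
(here `√8 = 2√2`). -/
def weberConst (r : K) (N : ℕ) : K :=
  if 3 ∣ N then r ^ (8 / (N / 3)) else (2 * r) ^ (8 / N)

/-- The second form defining the Weber curve `W_N` in `ℙ³`. -/
def weberForm₂ (r : K) (N : ℕ) : MvPolynomial (Fin 4) K :=
  X 0 * X 1 * X 2 - C (weberConst r N) * X 3 ^ 3

/-- The (`K`-rational points of the) Weber curve `W_N` in `ℙ³`. -/
def weberCurve (r : K) (N : ℕ) : Set (ℙ K (Fin 4 → K)) :=
  {P | eval P.rep (weberForm₁ K N) = 0 ∧ eval P.rep (weberForm₂ r N) = 0}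

/-- Jacobian criterion: the gradients of the two forms defining `W_N` are linearly independent
at `P`. -/
def IsNonsingularAt (r : K) (N : ℕ) (P : ℙ K (Fin 4 → K)) : Prop :=
  LinearIndependent K
    ![fun j => eval P.rep (pderiv j (weberForm₁ K N)),
      fun j => eval P.rep (pderiv j (weberForm₂ r N))]

/-- The map `(X₀ : X₁ : X₂ : X₃) ↦ (X₀ᵐ : X₁ᵐ : X₂ᵐ : X₃ᵐ)`; it induces the covers
`W_{mn} → W_n`. -/
def powMap (m : ℕ) : ℙ K (Fin 4 → K) → ℙ K (Fin 4 → K) :=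
  Projectivization.lift
    (fun v => Projectivization.mk K (fun j => v.1 j ^ m) (by
      intro h
      apply v.2
      funext j
      exact eq_zero_of_pow_eq_zero (congrFun h j)))
    (by
      intro a b t hab
      rw [Projectivization.mk_eq_mk_iff']
      refine ⟨t ^ m, ?_⟩
      funext j
      simp [hab, mul_pow])

/-- The diagonal automorphism `(X₀ : X₁ : X₂ : X₃) ↦ (h₀X₀ : h₁X₁ : h₂X₂ : X₃)` of `ℙ³`. -/
def scaleMap (h : Fin 3 → Kˣ) : ℙ K (Fin 4 → K) → ℙ K (Fin 4 → K) :=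
  Projectivization.map
    (LinearEquiv.piCongrRight fun j : Fin 4 =>
      LinearEquiv.smulOfUnit (M := K) ((![h 0, h 1, h 2, 1] : Fin 4 → Kˣ) j)).toLinearMap
    (LinearEquiv.injective _)

/-- Restriction of forms to the affine chart `X₃ = 1` of `ℙ³`. -/
def dehomogenize : MvPolynomial (Fin 4) K →ₐ[K] MvPolynomial (Fin 3) K :=
  aeval ![X 0, X 1, X 2, 1]

/-- The ideal of the affine Weber curve `W_N ∩ {X₃ ≠ 0}` in `𝔸³`. -/
def weberIdeal (r : K) (N : ℕ) : Ideal (MvPolynomial (Fin 3) K) :=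
  Ideal.span {dehomogenize (weberForm₁ K N), dehomogenize (weberForm₂ r N)}

/-- The coordinate ring of the affine Weber curve `W_N ∩ {X₃ ≠ 0}`. As `W_N` has only finitely many
points with `X₃ = 0`, its fraction field (when it is a domain) is the function field of `W_N`. -/
abbrev WeberRing (r : K) (N : ℕ) : Type _ := MvPolynomial (Fin 3) K ⧸ weberIdeal r N

/-- The coordinate function `x_i = X_i / X₃` on the affine Weber curve. -/
def coord (r : K) (N : ℕ) (i : Fin 3) : WeberRing r N := Ideal.Quotient.mk _ (X i)

lemma coord_rel₁ (r : K) (N : ℕ) :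
    if 3 ∣ N then
      coord r N 0 ^ (N / 3) + coord r N 1 ^ (N / 3) + coord r N 2 ^ (N / 3) = 0
    else coord r N 0 ^ N + coord r N 1 ^ N + coord r N 2 ^ N = 48 := by
  have h : Ideal.Quotient.mk (weberIdeal r N) (dehomogenize (weberForm₁ K N)) = 0 :=
    Ideal.Quotient.eq_zero_iff_mem.2 (Ideal.subset_span (by simp))
  split_ifs with h3
  · simpa [weberForm₁, dehomogenize, h3, coord] using h
  · have e : (algebraMap K (WeberRing r N)) 48 = 48 := map_ofNat _ 48
    have e' : Ideal.Quotient.mk (weberIdeal r N) (C 48) = 48 := e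
    simpa [weberForm₁, dehomogenize, h3, coord, sub_eq_zero, e', e] using h

lemma coord_rel₂ (r : K) (N : ℕ) :
    coord r N 0 * coord r N 1 * coord r N 2 = algebraMap K _ (weberConst r N) := by
  have h : Ideal.Quotient.mk (weberIdeal r N) (dehomogenize (weberForm₂ r N)) = 0 :=
    Ideal.Quotient.eq_zero_iff_mem.2 (Ideal.subset_span (by simp))
  rw [← sub_eq_zero]
  simpa [weberForm₂, dehomogenize, coord] using! h

lemma weberConst_pow {r : K} (hr : r ^ 2 = 2) {m n : ℕ} (h : m * n ∣ 24) :
    weberConst r (m * n) ^ m = weberConst r n := by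
  have hm : m ∣ 24 := (Dvd.intro _ rfl).trans h
  have hn : n ∣ 24 := (Dvd.intro_left _ rfl).trans h
  have hm' : m ∈ Nat.divisors 24 := by simp [hm]
  have hn' : n ∈ Nat.divisors 24 := by simp [hn]
  rw [show Nat.divisors 24 = {1, 2, 3, 4, 6, 8, 12, 24} by decide] at hm' hn'
  have h3 : (2 : K) * r = r ^ 3 := by rw [← hr]; ring
  simp only [Finset.mem_insert, Finset.mem_singleton] at hm' hn'
  unfold weberConst
  rw [h3]
  rcases hm' with rfl | rfl | rfl | rfl | rfl | rfl | rfl | rfl <;>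
  rcases hn' with rfl | rfl | rfl | rfl | rfl | rfl | rfl | rfl <;>
  first
  | (exfalso; revert h; decide)
  | (norm_num; try ring)

lemma coord_pow_rel {r : K} (hr : r ^ 2 = 2) {m n : ℕ} (h : m * n ∣ 24) :
    if 3 ∣ n then
      (coord r (m * n) 0 ^ m) ^ (n / 3) + (coord r (m * n) 1 ^ m) ^ (n / 3)
        + (coord r (m * n) 2 ^ m) ^ (n / 3) = 0
    else (coord r (m * n) 0 ^ m) ^ n + (coord r (m * n) 1 ^ m) ^ n
        + (coord r (m * n) 2 ^ m) ^ n = 48 := by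
  have h1 := coord_rel₁ r (m * n)
  have h2 := coord_rel₂ r (m * n)
  split_ifs with h3
  · rw [if_pos (h3.mul_left m), Nat.mul_div_assoc m h3] at h1
    simpa only [← pow_mul] using h1
  · by_cases hm : 3 ∣ m
    · obtain ⟨k, rfl⟩ := hm
      rw [if_pos ⟨k * n, by ring⟩, show 3 * k * n / 3 = k * n by
        rw [mul_assoc]; exact Nat.mul_div_cancel_left _ (by norm_num)] at h1
      have hc : weberConst r (3 * k * n) ^ (k * n) = 16 := by
        have h4 : 3 ∣ 3 * k * n := ⟨k * n, by ring⟩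
        have h5 : 3 * k * n / 3 = k * n := by
          rw [mul_assoc]; exact Nat.mul_div_cancel_left _ (by norm_num)
        have h6 : k * n ∣ 8 := by
          rw [mul_assoc] at h
          exact Nat.dvd_of_mul_dvd_mul_left (by norm_num : 0 < 3) (by simpa using h)
        rw [weberConst, if_pos h4, h5, ← pow_mul, Nat.div_mul_cancel h6]
        calc r ^ 8 = (r ^ 2) ^ 4 := by ring
          _ = 16 := by rw [hr]; norm_num
      have h7 := congrArg (fun t => t ^ (k * n)) h2
      simp only [mul_pow, ← map_pow] at h7
      rw [hc, map_ofNat] at h7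
      have e : ∀ x : WeberRing r (3 * k * n), (x ^ (3 * k)) ^ n = (x ^ (k * n)) ^ 3 := by
        intro x; ring
      rw [e, e, e]
      generalize coord r (3 * k * n) 0 ^ (k * n) = a at *
      generalize coord r (3 * k * n) 1 ^ (k * n) = b at *
      generalize coord r (3 * k * n) 2 ^ (k * n) = c at *
      linear_combination (a ^ 2 + b ^ 2 + c ^ 2 - a * b - b * c - c * a) * h1 + 3 * h7
    · have : ¬ 3 ∣ m * n := by
        rw [Nat.Prime.dvd_mul Nat.prime_three]; tauto
      rw [if_neg this] at h1
      simpa only [← pow_mul] using h1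

/-- Pullback of functions along the cover `W_{mn} → W_n`: `x_i ↦ x_iᵐ`. -/
def pullback {r : K} (hr : r ^ 2 = 2) {m n : ℕ} (h : m * n ∣ 24) :
    WeberRing r n →ₐ[K] WeberRing r (m * n) :=
  Ideal.Quotient.liftₐ (weberIdeal r n) (aeval fun i => coord r (m * n) i ^ m) (by
    intro a ha
    have hle : weberIdeal r n ≤
        RingHom.ker (aeval (R := K) fun i => coord r (m * n) i ^ m) := by
      rw [weberIdeal, Ideal.span_le]
      rintro x (rfl | rfl)
      · have := coord_pow_rel hr h
        rw [SetLike.mem_coe, RingHom.mem_ker]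
        split_ifs at this with h3
        · simpa [weberForm₁, dehomogenize, h3] using this
        · have e : (algebraMap K (WeberRing r (m * n))) 48 = 48 := map_ofNat _ 48
          simpa [weberForm₁, dehomogenize, h3, sub_eq_zero, e] using this
      · have := coord_rel₂ r (m * n)
        rw [SetLike.mem_coe, RingHom.mem_ker]
        simp only [weberForm₂, dehomogenize, map_sub, map_mul, map_pow, aeval_X, algHom_C,
          Matrix.cons_val, one_pow, mul_one, ← mul_pow, this]
        simp only [algebraMap_eq, algHom_C]
        rw [← weberConst_pow hr h, map_pow, sub_self]
    exact hle ha)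

/-- The function field of the Weber curve `W_N`. -/
abbrev WeberField (r : K) (N : ℕ) : Type _ := FractionRing (WeberRing r N)

/-- The coordinate function `X_i / X₃` in the function field of `W_N`. -/
def coordFun (r : K) (N : ℕ) (i : Fin 3) : WeberField r N :=
  algebraMap (WeberRing r N) (WeberField r N) (coord r N i)

/-- The function field of `W_n`, as a subfield of the function field of `W_{mn}` through pullback
along the cover `W_{mn} → W_n`. -/
def pullbackField {r : K} (hr : r ^ 2 = 2) {m n : ℕ} (h : m * n ∣ 24)
    [IsDomain (WeberRing r n)] [IsDomain (WeberRing r (m * n))]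
    (hinj : Function.Injective (pullback hr h).toRingHom) : Subfield (WeberField r (m * n)) :=
  (IsFractionRing.map (K := WeberField r n) (L := WeberField r (m * n)) hinj).fieldRange

/-- The action on `ℙ³` of an element of `μ_m³`. -/
abbrev rootAct {m : ℕ} (h : Fin 3 → rootsOfUnity m K) : ℙ K (Fin 4 → K) → ℙ K (Fin 4 → K) :=
  scaleMap fun i => (h i : Kˣ)

end Curves

/-! ### Subgroups of `μ_m³` -/

/-- The antidiagonal group `∇(μ_m²) = {(a, b, (ab)⁻¹)}` in `μ_m³`. -/
def antidiagonalGroup (m : ℕ) (K : Type*) [Field K] : Subgroup (Fin 3 → rootsOfUnity m K) where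
  carrier := {h | ∃ a b : rootsOfUnity m K, h = ![a, b, (a * b)⁻¹]}
  one_mem' := ⟨1, 1, by funext i; fin_cases i <;> simp⟩
  mul_mem' := by
    rintro _ _ ⟨a, b, rfl⟩ ⟨c, d, rfl⟩
    refine ⟨a * c, b * d, ?_⟩
    funext i
    fin_cases i
    · rfl
    · rfl
    · simp [mul_comm, mul_left_comm, mul_assoc]
  inv_mem' := by
    rintro _ ⟨a, b, rfl⟩
    refine ⟨a⁻¹, b⁻¹, ?_⟩
    funext i
    fin_cases i
    · rfl
    · rfl
    · simp [mul_comm]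

/-- The diagonal group `Δ(μ_m) = {(a, a, a)}` in `μ_m³`. -/
def diagonalGroup (m : ℕ) (K : Type*) [Field K] : Subgroup (Fin 3 → rootsOfUnity m K) where
  carrier := {h | ∃ a : rootsOfUnity m K, h = fun _ => a}
  one_mem' := ⟨1, rfl⟩
  mul_mem' := by
    rintro _ _ ⟨a, rfl⟩ ⟨b, rfl⟩
    exact ⟨a * b, rfl⟩
  inv_mem' := by
    rintro _ ⟨a, rfl⟩
    exact ⟨a⁻¹, rfl⟩

end

end Weber

/-!
The generators `S` and `T` of `SL₂(ℤ)` permute the `𝔲_i` up to 24th roots of unity, while `T²` and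
`ST²S` only scale them, by `(ζ₂₄⁻¹, ζ₂₄⁻¹, ζ₂₄²)` and `(ζ₂₄⁻¹, ζ₂₄², ζ₂₄⁻¹)`. On the powers
`𝔲_i^(24/(mn))` the group `Γ_n` therefore acts through triples of roots of unity. These triples
lie in `coverGroup m K`, powers of the two scalings realise every element of it, and the kernel of
the resulting homomorphism is `Γ_{mn}`.

On `W₂₄` the functions `u = x₁/x₀` and `Y = 1/x₀` satisfy `16 Y²⁴ + u⁸(u⁸ + 1) = 0`, which is
irreducible by Eisenstein's criterion, so that `W₂₄` is integral; the other `W_N` inherit this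
because the pullback of functions along `π` is injective. If `3 ∤ m`, injectivity holds because
every point of `W_n` lifts after an extension of scalars. If `3 ∣ m`, the first equation of `W_n`
becomes `a₀³ + a₁³ + a₂³ = 3a₀a₁a₂` for suitable roots `a_i` of the coordinates, and this splits
into three Lagrange resolvents `a₀ + θa₁ + θ²a₂`. A point lifts as soon as one of them vanishes, so
a function that pulls back to zero is divisible by all three. Such a function is annihilated by
`3(a₀³ - a₀a₁a₂) = 3(x₀ⁿ - 16)`, and the coordinate ring is free over `K[x₀, x₀⁻¹]`.

Two affine points of `W_{mn}` with the same image differ by a triple of roots of unity, which lies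
in `coverGroup m K` unless `3 ∣ m` and the `a_i³` all agree, in which case the image is singular.
Applied to the generic point of `W_{mn}` this determines the automorphisms of the Kummer extension
`K(W_{mn}) / K(W_n)`.
-/

namespace Weber

/-! ### Euler products and the Weber functions -/

section EulerProduct

open scoped ComplexConjugate

/-- Euler's product `∏ (1 - qⁿ)` over `n ≥ 1`, so that `η(τ) = e^(2πiτ/24) ∏ (1 - qⁿ)` with
`q = e^(2πiτ)`. -/
noncomputable def eulerProd (q : ℂ) : ℂ := ∏' n : ℕ, (1 - q ^ (n + 1))

lemma multipliable_one_sub_pow_odd {q : ℂ} (hq : ‖q‖ < 1) :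
    Multipliable fun n : ℕ => 1 - q ^ (2 * n + 1) := by
  apply multipliable_one_add_of_summable (f := fun n ↦ -q ^ (2 * n + 1))
  have hinj : Function.Injective fun n : ℕ => 2 * n + 1 := fun a b h => by simpa using h
  simpa [Function.comp_def] using
    (summable_geometric_of_lt_one (norm_nonneg _) hq).comp_injective hinj

lemma norm_pow_lt_one {q : ℂ} (hq : ‖q‖ < 1) {k : ℕ} (hk : k ≠ 0) : ‖q ^ k‖ < 1 := by
  rw [norm_pow]
  exact pow_lt_one₀ (norm_nonneg _) hq hk

lemma tprod_odd_mul_eulerProd_sq {q : ℂ} (hq : ‖q‖ < 1) :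
    (∏' n : ℕ, (1 - q ^ (2 * n + 1))) * eulerProd (q ^ 2) = eulerProd q := by
  have he : (fun k : ℕ => 1 - q ^ (2 * k + 1 + 1)) = fun k : ℕ => 1 - (q ^ 2) ^ (k + 1) := by
    funext k; ring
  have := tprod_even_mul_odd (f := fun n : ℕ => 1 - q ^ (n + 1)) (multipliable_one_sub_pow_odd hq)
    (by rw [he]; exact ModularForm.multipliable_one_sub_pow (norm_pow_lt_one hq two_ne_zero))
  rwa [he] at this

lemma tprod_odd_mul_tprod_odd_neg {p : ℂ} (hp : ‖p‖ < 1) :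
    (∏' n : ℕ, (1 - p ^ (2 * n + 1))) * (∏' n : ℕ, (1 - (-p) ^ (2 * n + 1))) =
      ∏' n : ℕ, (1 - (p ^ 2) ^ (2 * n + 1)) := by
  have hp' : ‖-p‖ < 1 := by rwa [norm_neg]
  rw [← (multipliable_one_sub_pow_odd hp).tprod_mul (multipliable_one_sub_pow_odd hp')]
  congr 1
  funext n
  rw [Odd.neg_pow ⟨n, rfl⟩]
  ring

lemma eulerProd_mul_eulerProd_neg_mul {p : ℂ} (hp : ‖p‖ < 1) :
    eulerProd p * eulerProd (-p) * eulerProd (p ^ 4) = eulerProd (p ^ 2) ^ 3 := by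
  have h2 := tprod_odd_mul_eulerProd_sq (q := -p) (by rwa [norm_neg])
  have h3 := tprod_odd_mul_eulerProd_sq (norm_pow_lt_one hp two_ne_zero)
  rw [neg_sq] at h2
  rw [← pow_mul, ← tprod_odd_mul_tprod_odd_neg hp] at h3
  rw [← tprod_odd_mul_eulerProd_sq hp, ← h2]
  linear_combination eulerProd (p ^ 2) ^ 2 * h3

lemma conj_eulerProd {q : ℂ} (hq : ‖q‖ < 1) : conj (eulerProd q) = eulerProd (conj q) := by
  simpa [eulerProd] using
    (ModularForm.multipliable_one_sub_pow hq).map_tprod (starRingEnd ℂ)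
      Complex.continuous_conj

end EulerProduct

section Eta

open Complex hiding eta
open ModularForm (eta)
open scoped Real ComplexConjugate

lemma norm_exp_two_pi_I_mul_lt_one {z : ℂ} (hz : 0 < z.im) : ‖exp (2 * π * I * z)‖ < 1 := by
  rw [norm_exp, Real.exp_lt_one_iff]
  simpa using mul_pos Real.two_pi_pos hz

lemma eta_eq_exp_mul_eulerProd (z : ℂ) :
    eta z = exp (2 * π * I * z / 24) * eulerProd (exp (2 * π * I * z)) := by
  simp [eta, eulerProd, ModularForm.eta_q, Function.Periodic.qParam]

lemma zeta_mul_pow (a b : ℕ) (hb : b ≠ 0) : zeta (a * b) ^ b = zeta a := by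
  rw [zeta, zeta, ← exp_nat_mul]
  congr 1
  have : (b : ℂ) ≠ 0 := Nat.cast_ne_zero.2 hb
  push_cast
  field_simp

lemma zeta_ne_zero (k : ℕ) : zeta k ≠ 0 := exp_ne_zero _

lemma zeta_isPrimitiveRoot {k : ℕ} (hk : k ≠ 0) : IsPrimitiveRoot (zeta k) k :=
  isPrimitiveRoot_exp k hk

lemma zeta_48_pow_three : zeta 48 ^ 3 = zeta 16 := zeta_mul_pow 16 3 three_ne_zero

lemma zeta_48_pow_two : zeta 48 ^ 2 = zeta 24 := zeta_mul_pow 24 2 two_ne_zero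

lemma eta_add_one (z : ℂ) : eta (z + 1) = zeta 24 * eta z := by
  rw [eta_eq_exp_mul_eulerProd, eta_eq_exp_mul_eulerProd, zeta, ← mul_assoc, ← exp_add]
  congr 2
  · push_cast; ring
  · rw [mul_add, mul_one, exp_add, exp_two_pi_mul_I, mul_one]

lemma eta_neg_inv {z : ℂ} (hz : 0 < z.im) :
    eta (-z⁻¹) = (sqrt I)⁻¹ * sqrt z * eta z := by
  simpa [neg_div, mul_assoc] using ModularForm.eta_comp_eq_csqrt_I_inv (x := z) hz

lemma sqrt_ne_zero {z : ℂ} (hz : z ≠ 0) : sqrt z ≠ 0 := by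
  rw [sqrt_eq_exp hz]
  exact exp_ne_zero _

lemma sqrt_ofReal_mul {x : ℝ} (hx : 0 < x) {z : ℂ} (hz : z ≠ 0) :
    sqrt (x * z) = (√x : ℂ) * sqrt z := by
  rw [sqrt_eq_exp hz, sqrt_eq_exp (mul_ne_zero (ofReal_ne_zero.2 hx.ne') hz),
    log_ofReal_mul hx hz, add_div, exp_add]
  congr 1
  rw [Real.sqrt_eq_rpow, Real.rpow_def_of_pos hx]
  push_cast
  ring_nf

lemma sqrt_two_mul_sqrt_half : (√2 : ℂ) * (√(1 / 2 : ℝ) : ℂ) = 1 := by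
  rw [← ofReal_mul, ← Real.sqrt_mul zero_le_two]
  norm_num

lemma eta_neg_inv_div_two {z : ℂ} (hz : 0 < z.im) (hz0 : z ≠ 0) :
    eta (-z⁻¹ / 2) = (sqrt I)⁻¹ * (√2 * sqrt z) * eta (2 * z) := by
  have h := eta_neg_inv (z := (2 : ℝ) * z) (by simpa using hz)
  rw [sqrt_ofReal_mul two_pos hz0, ofReal_ofNat] at h
  convert h using 2
  field_simp

lemma sqrt_two_mul_eta_two_mul_neg_inv {z : ℂ} (hz : 0 < z.im) (hz0 : z ≠ 0) :
    √2 * eta (2 * -z⁻¹) = (sqrt I)⁻¹ * sqrt z * eta (z / 2) := by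
  have h := eta_neg_inv (z := (1 / 2 : ℝ) * z) (by simpa using hz)
  have e1 : -(((1 / 2 : ℝ) : ℂ) * z)⁻¹ = 2 * -z⁻¹ := by push_cast; field_simp
  have e2 : ((1 / 2 : ℝ) : ℂ) * z = z / 2 := by push_cast; ring
  rw [sqrt_ofReal_mul (by norm_num) hz0, e1, e2] at h
  rw [h]
  linear_combination ((sqrt I)⁻¹ * sqrt z * eta (z / 2)) * sqrt_two_mul_sqrt_half

lemma eta_half_add_mul_eta_half_mul_eta_two_mul {z : ℂ} (hz : 0 < z.im) :
    eta ((z + 1) / 2) * eta (z / 2) * eta (2 * z) = zeta 48 * eta z ^ 3 := by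
  set p := exp (2 * π * I * (z / 2)) with hp
  have hp1 : ‖p‖ < 1 := norm_exp_two_pi_I_mul_lt_one (by simpa using hz)
  have e1 : exp (2 * π * I * ((z + 1) / 2)) = -p := by
    rw [hp, show 2 * π * I * ((z + 1) / 2) =
      2 * π * I * (z / 2) + π * I by ring, exp_add, exp_pi_mul_I]
    ring
  have e2 : exp (2 * π * I * (2 * z)) = p ^ 4 := by
    rw [hp, ← exp_nat_mul]; congr 1; push_cast; ring
  have e3 : exp (2 * π * I * z) = p ^ 2 := by
    rw [hp, ← exp_nat_mul]; congr 1; push_cast; ring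
  have hexp : exp (2 * π * I * ((z + 1) / 2) / 24) * exp (2 * π * I * (z / 2) / 24) *
      exp (2 * π * I * (2 * z) / 24) = zeta 48 * exp (2 * π * I * z / 24) ^ 3 := by
    rw [zeta, ← exp_nat_mul, ← exp_add, ← exp_add, ← exp_add]
    congr 1
    push_cast
    ring
  simp only [eta_eq_exp_mul_eulerProd]
  rw [e1, e2, e3, ← hp, mul_pow, ← eulerProd_mul_eulerProd_neg_mul hp1]
  linear_combination (eulerProd p * eulerProd (-p) * eulerProd (p ^ 4)) * hexp

lemma conj_eta {z : ℂ} (hz : 0 < z.im) : conj (eta z) = eta (-conj z) := by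
  have h (w : ℂ) : conj (exp (2 * π * I * w)) = exp (2 * π * I * -conj w) := by
    rw [← exp_conj]
    congr 1
    simp [conj_ofNat]
  rw [eta_eq_exp_mul_eulerProd, eta_eq_exp_mul_eulerProd, map_mul,
    conj_eulerProd (norm_exp_two_pi_I_mul_lt_one hz), h, mul_div_assoc, h, mul_div_assoc, map_div₀,
    map_ofNat, neg_div]

end Eta

section WeberFunctions

open Complex hiding eta
open ModularForm (eta)
open ModularGroup (S T)
open scoped Real ComplexConjugate

lemma eta_coe_ne_zero (τ : ℍ) : eta (τ : ℂ) ≠ 0 := ModularForm.eta_ne_zero τ.2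

lemma weberF_mul_weberF₁_mul_weberF₂ (τ : ℍ) : weberF τ * weberF₁ τ * weberF₂ τ = √2 := by
  have h48 := zeta_ne_zero 48
  have h0 := eta_coe_ne_zero τ
  have h := eta_half_add_mul_eta_half_mul_eta_two_mul τ.2
  rw [weberF, weberF₁, weberF₂]
  field_simp
  rw [mul_comm (2 : ℂ) τ] at h
  linear_combination h

lemma weberU_mul (τ : ℍ) : weberU 0 τ * weberU 1 τ * weberU 2 τ = √2 := by
  have h := zeta_ne_zero 16
  rw [← weberF_mul_weberF₁_mul_weberF₂ τ]
  simp only [weberU, Matrix.cons_val]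
  field_simp

lemma weberU_ne_zero (i : Fin 3) (τ : ℍ) : weberU i τ ≠ 0 := by
  have h : weberU 0 τ * weberU 1 τ * weberU 2 τ ≠ 0 := by
    rw [weberU_mul, ofReal_ne_zero]
    positivity
  rw [mul_ne_zero_iff, mul_ne_zero_iff] at h
  fin_cases i
  exacts [h.1.1, h.1.2, h.2]

lemma coe_T_smul (τ : ℍ) : ((T • τ : ℍ) : ℂ) = τ + 1 := by
  rw [UpperHalfPlane.modular_T_smul, UpperHalfPlane.coe_vadd, ofReal_one, add_comm]

lemma coe_S_smul (τ : ℍ) : ((S • τ : ℍ) : ℂ) = -(τ : ℂ)⁻¹ := by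
  rw [UpperHalfPlane.modular_S_smul]
  simp [inv_neg]

lemma weberU_T_smul (τ : ℍ) :
    weberU 0 (T • τ) = (zeta 24 ^ 2)⁻¹ * weberU 1 τ ∧ weberU 1 (T • τ) = zeta 24 * weberU 0 τ ∧
      weberU 2 (T • τ) = zeta 24 * weberU 2 τ := by
  have h48 := zeta_ne_zero 48
  have h0 := eta_coe_ne_zero τ
  have h2 : eta (((τ : ℂ) + 1 + 1) / 2) = zeta 24 * eta ((τ : ℂ) / 2) := by
    rw [← eta_add_one]; congr 1; ring
  have h3 : eta (2 * ((τ : ℂ) + 1)) = zeta 24 * (zeta 24 * eta (2 * (τ : ℂ))) := by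
    rw [← eta_add_one, ← eta_add_one]; congr 1; ring
  simp only [weberU, weberF, weberF₁, weberF₂, Matrix.cons_val, coe_T_smul]
  rw [eta_add_one, h2, h3, ← zeta_48_pow_three, ← zeta_48_pow_two]
  refine ⟨?_, ?_, ?_⟩ <;> field_simp

lemma weberU_one_S_smul (τ : ℍ) : weberU 1 (S • τ) = zeta 24 ^ 3 * weberU 2 τ := by
  have h48 := zeta_ne_zero 48
  have h0 := eta_coe_ne_zero τ
  have hI := sqrt_ne_zero I_ne_zero
  have hs := sqrt_ne_zero τ.ne_zero
  simp only [weberU, weberF₁, weberF₂, Matrix.cons_val, coe_S_smul]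
  rw [eta_neg_inv τ.2, eta_neg_inv_div_two τ.2 τ.ne_zero, ← zeta_48_pow_three, ← zeta_48_pow_two]
  field_simp

lemma weberU_two_S_smul (τ : ℍ) : weberU 2 (S • τ) = (zeta 24 ^ 3)⁻¹ * weberU 1 τ := by
  have h48 := zeta_ne_zero 48
  have h0 := eta_coe_ne_zero τ
  have hI := sqrt_ne_zero I_ne_zero
  have hs := sqrt_ne_zero τ.ne_zero
  simp only [weberU, weberF₁, weberF₂, Matrix.cons_val, coe_S_smul]
  rw [sqrt_two_mul_eta_two_mul_neg_inv τ.2 τ.ne_zero, eta_neg_inv τ.2, ← zeta_48_pow_three,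
    ← zeta_48_pow_two]
  field_simp

lemma weberU_zero_S_smul (τ : ℍ) : weberU 0 (S • τ) = weberU 0 τ := by
  have h24 := zeta_ne_zero 24
  have h := (weberU_mul (S • τ)).trans (weberU_mul τ).symm
  rw [weberU_one_S_smul, weberU_two_S_smul] at h
  field_simp at h
  apply mul_right_cancel₀ (mul_ne_zero (weberU_ne_zero 1 τ) (weberU_ne_zero 2 τ))
  linear_combination h

lemma zeta_sixteen_pow : zeta 16 ^ 24 = -1 := by
  rw [show 24 = 8 * 3 from rfl, pow_mul, zeta_mul_pow 2 8 (by norm_num),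
    (zeta_isPrimitiveRoot two_ne_zero).eq_neg_one_of_two_right]
  norm_num

lemma zeta_24_pow_eq_one (k : ℕ) : (zeta 24 ^ k) ^ 24 = 1 := by
  rw [pow_right_comm, (zeta_isPrimitiveRoot (by norm_num)).pow_eq_one, one_pow]

lemma exists_weberF₁_I_eq_ofReal : ∃ x : ℝ, weberF₁ UpperHalfPlane.I = x := by
  have hreal (y : ℂ) (hy : 0 < y.im) (hy' : -conj y = y) : conj (eta y) = eta y := by
    rw [conj_eta hy, hy']
  rw [← conj_eq_iff_real, weberF₁, UpperHalfPlane.coe_I, map_div₀, hreal I (by simp) (by simp),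
    hreal (I / 2) (by simp) (by rw [map_div₀, conj_I, conj_ofNat]; ring)]

lemma exists_weberU_zero_pow_ne : ∃ τ, weberU 0 τ ^ 24 ≠ weberU 1 τ ^ 24 := by
  -- Otherwise `𝔲₀²⁴ = 𝔲₁²⁴ = 𝔲₂²⁴` by `S`, so `𝔲₁(i)⁷² = 2¹²`; but `𝔲₁(i)⁷² = -𝔣₁(i)⁷² < 0`.
  by_contra! h
  have h2 (τ : ℍ) : weberU 2 τ ^ 24 = weberU 1 τ ^ 24 := by
    rw [← h, ← weberU_zero_S_smul, h, weberU_one_S_smul, mul_pow, zeta_24_pow_eq_one, one_mul]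
  obtain ⟨x, hx⟩ := exists_weberF₁_I_eq_ofReal
  have h1 : weberU 1 UpperHalfPlane.I ^ 24 = -(x : ℂ) ^ 24 := by
    simp only [weberU, Matrix.cons_val, hx, mul_pow, zeta_sixteen_pow, neg_one_mul]
  have hprod : (-(x : ℂ) ^ 24) ^ 3 = (√2 : ℂ) ^ 24 := by
    rw [← weberU_mul UpperHalfPlane.I, mul_pow, mul_pow, h, h2, h1]
    ring
  have hprod' : (-x ^ 24) ^ 3 = √2 ^ 24 := by exact_mod_cast hprod
  have hx0 : 0 ≤ (x ^ 24) ^ 3 := by positivity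
  have h2pos : 0 < √2 ^ 24 := by positivity
  linarith [show (-x ^ 24) ^ 3 = -(x ^ 24) ^ 3 by ring]

lemma eq_of_symmetric_fin_three {P : Fin 3 → Fin 3 → Prop} (hP : ∀ i j, P i j → P j i)
    (h01 : ¬ P 0 1) (h02 : ¬ P 0 2) (h12 : ¬ P 1 2) {i j : Fin 3} (h : P i j) : i = j := by
  have h10 := mt (hP 1 0) h01
  have h20 := mt (hP 2 0) h02
  have h21 := mt (hP 2 1) h12
  fin_cases i <;> fin_cases j <;> first | rfl | contradiction

lemma weberU_pow_injective {i j : Fin 3} (h : ∀ τ, weberU i τ ^ 24 = weberU j τ ^ 24) :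
    i = j := by
  have hz : zeta 24 ^ 24 = 1 := by simpa using zeta_24_pow_eq_one 1
  have h01 : ¬ ∀ τ, weberU 0 τ ^ 24 = weberU 1 τ ^ 24 :=
    not_forall.2 exists_weberU_zero_pow_ne
  have h02 : ¬ ∀ τ, weberU 0 τ ^ 24 = weberU 2 τ ^ 24 := fun h => h01 fun τ => by
    have h := h (S • τ)
    rwa [weberU_zero_S_smul, weberU_two_S_smul, mul_pow, inv_pow, zeta_24_pow_eq_one, inv_one,
      one_mul] at h
  have h12 : ¬ ∀ τ, weberU 1 τ ^ 24 = weberU 2 τ ^ 24 := fun h => h02 fun τ => by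
    have h := h (T • τ)
    rwa [(weberU_T_smul τ).2.1, (weberU_T_smul τ).2.2, mul_pow, mul_pow, hz, one_mul,
      one_mul] at h
  exact eq_of_symmetric_fin_three (P := fun i j => ∀ τ, weberU i τ ^ 24 = weberU j τ ^ 24)
    (fun _ _ h τ => (h τ).symm) h01 h02 h12 h

end WeberFunctions

/-! ### The Galois group -/

section CoverGroup

/-- The exponent `k` with `m = k` or `m = 3k` and `3 ∤ k`, for `m ∣ 24`. -/
def coverExp (m : ℕ) : ℕ := if 3 ∣ m then m / 3 else m

/-- The Galois group of the cover `W_{mn} → W_n`: the triples `h` in `μ_m³` with `h₀h₁h₂ = 1` for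
which `h_i ^ coverExp m` does not depend on `i`. -/
def coverGroup (m : ℕ) (K : Type*) [Field K] : Subgroup (Fin 3 → rootsOfUnity m K) where
  carrier := {h | ∏ i, h i = 1 ∧ ∀ i j, h i ^ coverExp m = h j ^ coverExp m}
  one_mem' := by simp
  mul_mem' := by
    rintro a b ⟨ha, ha'⟩ ⟨hb, hb'⟩
    refine ⟨by simp only [Pi.mul_apply, Finset.prod_mul_distrib, ha, hb, one_mul], fun i j => ?_⟩
    simp only [Pi.mul_apply, mul_pow, ha' i j, hb' i j]
  inv_mem' := by
    rintro a ⟨ha, ha'⟩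
    refine ⟨by simp only [Pi.inv_apply, Finset.prod_inv_distrib, ha, inv_one], fun i j => ?_⟩
    simp only [Pi.inv_apply, inv_pow, ha' i j]

lemma three_mul_coverExp {m : ℕ} (h : 3 ∣ m) : 3 * coverExp m = m := by
  rw [coverExp, if_pos h, Nat.mul_div_cancel' h]

lemma coverExp_of_not_dvd {m : ℕ} (h : ¬ 3 ∣ m) : coverExp m = m := if_neg h

lemma not_three_dvd_of_dvd_eight {m : ℕ} (hm : m ∣ 8) : ¬ 3 ∣ m := fun h => by
  have := h.trans hm
  revert this
  decide

lemma dvd_eight_of_not_three_dvd {m : ℕ} (hm : m ∣ 24) (h : ¬ 3 ∣ m) : m ∣ 8 :=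
  (Nat.prime_three.coprime_iff_not_dvd.2 h).symm.dvd_of_dvd_mul_left (n := 8) hm

variable {m : ℕ} {K L : Type*} [Field K] [Field L] [Algebra K L]

lemma comp_perm_mem_coverGroup {h : Fin 3 → rootsOfUnity m K} (hh : h ∈ coverGroup m K)
    (σ : Equiv.Perm (Fin 3)) : (fun i => h (σ i)) ∈ coverGroup m K :=
  ⟨(Equiv.prod_comp σ h).trans hh.1, fun i j => hh.2 (σ i) (σ j)⟩

lemma rootsOfUnity_pow_eq_one (x : rootsOfUnity m K) : x ^ m = 1 := Subtype.ext x.2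

lemma coverGroup_three : coverGroup 3 K = diagonalGroup 3 K := by
  ext h
  constructor
  · rintro ⟨-, hh⟩
    exact ⟨h 0, funext fun i => by simpa [coverExp] using hh i 0⟩
  · rintro ⟨a, rfl⟩
    exact ⟨by simpa using rootsOfUnity_pow_eq_one a, fun _ _ => rfl⟩

lemma coverGroup_of_dvd_eight (hm : m ∣ 8) : coverGroup m K = antidiagonalGroup m K := by
  have hpow (a : rootsOfUnity m K) : a ^ coverExp m = 1 := by
    rw [coverExp_of_not_dvd (not_three_dvd_of_dvd_eight hm)]
    exact rootsOfUnity_pow_eq_one a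
  ext h
  constructor
  · rintro ⟨hh, -⟩
    rw [Fin.prod_univ_three] at hh
    refine ⟨h 0, h 1, funext fun i => ?_⟩
    fin_cases i
    · rfl
    · rfl
    · exact eq_inv_of_mul_eq_one_right hh
  · rintro ⟨a, b, rfl⟩
    exact ⟨by simp [Fin.prod_univ_three], fun i j => by rw [hpow, hpow]⟩

/-- The inclusion of `μ_m` in `K`. -/
def rootVal : rootsOfUnity m K →* K := (Units.coeHom K).comp (rootsOfUnity m K).subtype

lemma rootVal_injective : Function.Injective (rootVal : rootsOfUnity m K →* K) :=
  Units.val_injective.comp Subtype.val_injective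

lemma algebraMap_rootVal_injective :
    Function.Injective fun x : rootsOfUnity m K => algebraMap K L (rootVal x) :=
  (algebraMap K L).injective.comp rootVal_injective

lemma rootVal_pow_eq_one (x : rootsOfUnity m K) : rootVal x ^ m = 1 := by
  rw [← map_pow, rootsOfUnity_pow_eq_one, map_one]

lemma exists_rootVal_algebraMap_eq [NeZero m] {ζ : K} (hζ : IsPrimitiveRoot ζ m) {c : L}
    (hc : c ^ m = 1) : ∃ y : rootsOfUnity m K, algebraMap K L (rootVal y) = c := by
  have hζL := hζ.map_of_injective (algebraMap K L).injective
  obtain ⟨i, -, hi⟩ := hζL.eq_pow_of_pow_eq_one hc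
  refine ⟨hζ.toRootsOfUnity ^ i, ?_⟩
  rw [map_pow, map_pow]
  exact hi

lemma exists_mem_coverGroup_algebraMap_eq [NeZero m] {ζ : K} (hζ : IsPrimitiveRoot ζ m)
    {c : Fin 3 → L} (hc : ∀ i, c i ^ m = 1) (hprod : ∏ i, c i = 1)
    (hpow : ∀ i j, c i ^ coverExp m = c j ^ coverExp m) :
    ∃ h ∈ coverGroup m K, ∀ i, algebraMap K L (rootVal (h i)) = c i := by
  choose h hh using fun i => exists_rootVal_algebraMap_eq hζ (hc i)
  refine ⟨h, ⟨algebraMap_rootVal_injective (L := L) ?_, fun i j =>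
    algebraMap_rootVal_injective (L := L) ?_⟩, hh⟩
  · simpa [Fin.prod_univ_three, hh] using hprod
  · simpa [hh] using hpow i j

lemma exists_pow_eq_one_cube_eq (hm : m ∣ 24) {ζ : K} (hζ : IsPrimitiveRoot ζ m) {x : K}
    (hx : x ^ coverExp m = 1) : ∃ y, y ^ m = 1 ∧ y ^ 3 = x := by
  have hm0 : m ≠ 0 := ne_zero_of_dvd_ne_zero (by norm_num) hm
  by_cases h3 : 3 ∣ m
  · have hk := three_mul_coverExp h3
    have : NeZero (coverExp m) := ⟨fun h => hm0 (by rw [← hk, h, mul_zero])⟩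
    obtain ⟨t, -, rfl⟩ := (hζ.pow hm0.bot_lt hk.symm).eq_pow_of_pow_eq_one hx
    exact ⟨ζ ^ t, by rw [pow_right_comm, hζ.pow_eq_one, one_pow], pow_right_comm ζ t 3⟩
  · rw [coverExp_of_not_dvd h3] at hx
    have hx8 : x ^ 8 = 1 := by
      obtain ⟨k, hk⟩ := dvd_eight_of_not_three_dvd hm h3
      rw [hk, pow_mul, hx, one_pow]
    exact ⟨x ^ 3, by rw [pow_right_comm, hx, one_pow], by linear_combination x * hx8⟩

lemma exists_eq_of_mem_coverGroup (hm : m ∣ 24) {ζ : K} (hζ : IsPrimitiveRoot ζ m)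
    {h : Fin 3 → rootsOfUnity m K} (hh : h ∈ coverGroup m K) :
    ∃ p q : rootsOfUnity m K, h = ![p⁻¹, p⁻¹, p ^ 2] * ![q⁻¹, q ^ 2, q⁻¹] := by
  obtain ⟨hprod, hpow⟩ := hh
  have : NeZero m := ⟨ne_zero_of_dvd_ne_zero (by norm_num) hm⟩
  obtain ⟨y, hy, hy3⟩ : ∃ y, y ^ m = 1 ∧ y ^ 3 = rootVal (h 1 / h 0) :=
    exists_pow_eq_one_cube_eq hm hζ (by
      have : (h 1 / h 0) ^ coverExp m = 1 := by rw [div_pow, hpow 1 0, div_self']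
      rw [← map_pow, this, map_one])
  obtain ⟨q, rfl⟩ := exists_rootVal_algebraMap_eq (L := K) hζ hy
  have hq : h 1 = q ^ 3 * h 0 := by
    rw [← div_eq_iff_eq_mul]
    exact rootVal_injective (by simpa only [map_pow, Algebra.algebraMap_self_apply] using hy3.symm)
  rw [Fin.prod_univ_three, hq] at hprod
  refine ⟨(h 0 * q)⁻¹, q, funext fun i => ?_⟩
  fin_cases i
  · simp
  · simp only [Fin.mk_one, hq, Pi.mul_apply, Matrix.cons_val, inv_inv, pow_succ]
    ac_rfl
  · change h 2 = ((h 0 * q)⁻¹) ^ 2 * q⁻¹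
    rw [eq_inv_of_mul_eq_one_right hprod, inv_pow, ← mul_inv]
    congr 1
    simp only [pow_succ, pow_zero, one_mul]
    ac_rfl

end CoverGroup

/-! ### The action of the modular group -/

section ModularAction

open ModularGroup (S T)

lemma exists_weberU_S_smul : ∃ (σ : Equiv.Perm (Fin 3)), ∃ c ∈ coverGroup 24 ℂ,
    ∀ i τ, weberU i (S • τ) = rootVal (c i) * weberU (σ i) τ := by
  obtain ⟨z, hz⟩ := exists_rootVal_algebraMap_eq (L := ℂ) (zeta_isPrimitiveRoot (k := 24) (by simp))
    (zeta_isPrimitiveRoot (by simp)).pow_eq_one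
  rw [Algebra.algebraMap_self_apply] at hz
  have h8 (i : Fin 3) : (![1, z ^ 3, (z ^ 3)⁻¹] i) ^ coverExp 24 = 1 := by
    fin_cases i <;> simp [coverExp, ← pow_mul, rootsOfUnity_pow_eq_one]
  refine ⟨Equiv.swap 1 2, ![1, z ^ 3, (z ^ 3)⁻¹], ⟨by simp [Fin.prod_univ_three], fun i j => ?_⟩,
    fun i τ => ?_⟩
  · rw [h8, h8]
  · fin_cases i
    · simpa [Equiv.swap_apply_of_ne_of_ne] using weberU_zero_S_smul τ
    · simpa [hz] using weberU_one_S_smul τ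
    · simpa [hz] using weberU_two_S_smul τ

lemma exists_weberU_T_smul : ∃ (σ : Equiv.Perm (Fin 3)), ∃ c ∈ coverGroup 24 ℂ,
    ∀ i τ, weberU i (T • τ) = rootVal (c i) * weberU (σ i) τ := by
  obtain ⟨z, hz⟩ := exists_rootVal_algebraMap_eq (L := ℂ) (zeta_isPrimitiveRoot (k := 24) (by simp))
    (zeta_isPrimitiveRoot (by simp)).pow_eq_one
  rw [Algebra.algebraMap_self_apply] at hz
  have h8 (i : Fin 3) : (![(z ^ 2)⁻¹, z, z] i) ^ coverExp 24 = z ^ 8 := by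
    fin_cases i
    · simp only [coverExp, Fin.zero_eta, Matrix.cons_val_zero, inv_pow, ← pow_mul]
      exact inv_eq_of_mul_eq_one_left ((pow_add z 8 16).symm.trans (rootsOfUnity_pow_eq_one z))
    all_goals rfl
  refine ⟨Equiv.swap 0 1, ![(z ^ 2)⁻¹, z, z], ⟨by simp [Fin.prod_univ_three, sq], fun i j => ?_⟩,
    fun i τ => ?_⟩
  · rw [h8, h8]
  · obtain ⟨h0, h1, h2⟩ := weberU_T_smul τ
    fin_cases i
    · simpa [hz] using h0
    · simpa [hz] using h1
    · simpa [hz, Equiv.swap_apply_of_ne_of_ne] using h2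

lemma exists_weberU_smul (γ : SL(2, ℤ)) : ∃ (σ : Equiv.Perm (Fin 3)), ∃ c ∈ coverGroup 24 ℂ,
    ∀ i τ, weberU i (γ • τ) = rootVal (c i) * weberU (σ i) τ := by
  have hγ : γ ∈ Subgroup.closure {S, T} := by
    rw [SpecialLinearGroup.SL2Z_generators]
    trivial
  induction hγ using Subgroup.closure_induction with
  | mem x hx =>
    rcases hx with rfl | rfl
    exacts [exists_weberU_S_smul, exists_weberU_T_smul]
  | one => exact ⟨1, 1, one_mem _, by simp⟩
  | mul x y _ _ hx hy =>
    obtain ⟨σ, c, hc, hσ⟩ := hx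
    obtain ⟨ρ, d, hd, hρ⟩ := hy
    refine ⟨ρ * σ, _, mul_mem hc (comp_perm_mem_coverGroup hd σ), fun i τ => ?_⟩
    rw [mul_smul, hσ, hρ, Pi.mul_apply, map_mul, mul_assoc, Equiv.Perm.mul_apply]
  | inv x _ hx =>
    obtain ⟨σ, c, hc, hσ⟩ := hx
    refine ⟨σ⁻¹, _, inv_mem (comp_perm_mem_coverGroup hc σ⁻¹), fun i τ => ?_⟩
    have h := hσ (σ⁻¹ i) (x⁻¹ • τ)
    rw [smul_inv_smul, ← Equiv.Perm.mul_apply, mul_inv_cancel, Equiv.Perm.one_apply] at h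
    rw [h, ← mul_assoc, ← map_mul, Pi.inv_apply, inv_mul_cancel, map_one, one_mul]

lemma exists_weberU_smul_of_mem_weberKernelSL {n : ℕ} (hn : n ∣ 24) {γ : SL(2, ℤ)}
    (hγ : γ ∈ weberKernelSL n) :
    ∃ c ∈ coverGroup 24 ℂ, (∀ i, rootVal (c i) ^ (24 / n) = 1) ∧
      ∀ i τ, weberU i (γ • τ) = rootVal (c i) * weberU i τ := by
  obtain ⟨σ, c, hc, hσ⟩ := exists_weberU_smul γ
  have hσ1 (i : Fin 3) : σ i = i := weberU_pow_injective fun τ => by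
    have h := congrArg (· ^ n) (hγ i τ)
    simpa only [← pow_mul, Nat.div_mul_cancel hn, hσ, mul_pow, rootVal_pow_eq_one,
      one_mul] using h
  simp only [hσ1] at hσ
  refine ⟨c, hc, fun i => ?_, hσ⟩
  have h := hγ i UpperHalfPlane.I
  rw [hσ, mul_pow] at h
  exact (mul_eq_right₀ (pow_ne_zero _ (weberU_ne_zero _ _))).1 h

lemma weberU_pow_smul {i : Fin 3} {γ : SL(2, ℤ)} {c : ℂ}
    (h : ∀ τ, weberU i (γ • τ) = c * weberU i τ) (p : ℕ) (τ : ℍ) :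
    weberU i (γ ^ p • τ) = c ^ p * weberU i τ := by
  induction p generalizing τ with
  | zero => simp
  | succ p ih => rw [pow_succ, mul_smul, ih, h, pow_succ, mul_assoc]

lemma weberU_T_sq_smul (i : Fin 3) (τ : ℍ) :
    weberU i ((T * T) • τ) = ![(zeta 24)⁻¹, (zeta 24)⁻¹, zeta 24 ^ 2] i * weberU i τ := by
  have h0 := zeta_ne_zero 24
  obtain ⟨h, h', h''⟩ := weberU_T_smul τ
  obtain ⟨g, g', g''⟩ := weberU_T_smul (T • τ)
  rw [mul_smul]
  fin_cases i
  · simp only [Fin.zero_eta, g, h', Matrix.cons_val]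
    field_simp
  · simp only [Fin.mk_one, g', h, Matrix.cons_val]
    field_simp
  · simp only [Fin.reduceFinMk, g'', h'', Matrix.cons_val]
    ring

lemma weberU_S_mul_T_sq_mul_S_smul (i : Fin 3) (τ : ℍ) :
    weberU i ((S * (T * T) * S) • τ) =
      ![(zeta 24)⁻¹, zeta 24 ^ 2, (zeta 24)⁻¹] i * weberU i τ := by
  have h0 := zeta_ne_zero 24
  have h := fun i => weberU_T_sq_smul i (S • τ)
  rw [mul_smul, mul_smul]
  fin_cases i
  · simp only [Fin.zero_eta, weberU_zero_S_smul, h, Matrix.cons_val]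
  · simp only [Fin.mk_one, weberU_one_S_smul, weberU_two_S_smul, h, Matrix.cons_val]
    field_simp
  · simp only [Fin.reduceFinMk, weberU_one_S_smul, weberU_two_S_smul, h, Matrix.cons_val]
    field_simp

lemma exists_weberU_smul_eq (p q : ℕ) : ∃ γ : SL(2, ℤ), ∀ i τ, weberU i (γ • τ) =
    (![(zeta 24)⁻¹, (zeta 24)⁻¹, zeta 24 ^ 2] i) ^ p *
      (![(zeta 24)⁻¹, zeta 24 ^ 2, (zeta 24)⁻¹] i) ^ q * weberU i τ :=
  ⟨(T * T) ^ p * (S * (T * T) * S) ^ q, fun i τ => by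
    rw [mul_smul, weberU_pow_smul (weberU_T_sq_smul i),
      weberU_pow_smul (weberU_S_mul_T_sq_mul_S_smul i), mul_assoc]⟩

end ModularAction

section Multiplier

local notation "PSL₂ℤ" => Matrix.ProjectiveSpecialLinearGroup (Fin 2) ℤ

lemma smul_eq_of_mk_eq {γ δ : SL(2, ℤ)}
    (h : (QuotientGroup.mk γ : PSL₂ℤ) = QuotientGroup.mk δ) (τ : ℍ) : γ • τ = δ • τ := by
  rw [QuotientGroup.eq, Matrix.SpecialLinearGroup.mem_center_iff] at h
  obtain ⟨s, hs, h⟩ := h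
  rw [Fintype.card_fin, sq_eq_one_iff] at hs
  have hcenter : (γ⁻¹ * δ) • τ = τ := by
    rcases hs with rfl | rfl
    · rw [show γ⁻¹ * δ = 1 from Subtype.ext (by rw [← h]; simp), one_smul]
    · rw [show γ⁻¹ * δ = -1 from Subtype.ext (by rw [← h]; simp), ModularGroup.SL_neg_smul,
        one_smul]
  rw [mul_smul, inv_smul_eq_iff] at hcenter
  exact hcenter.symm

lemma mk_mem_weberGamma {N : ℕ} {γ : SL(2, ℤ)} :
    (QuotientGroup.mk γ : PSL₂ℤ) ∈ weberGamma N ↔ γ ∈ weberKernelSL N := by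
  refine ⟨?_, fun h => ⟨γ, h, rfl⟩⟩
  rintro ⟨δ, hδ, h⟩ i τ
  rw [← smul_eq_of_mk_eq h]
  exact hδ i τ

lemma div_eq_mul_div_mul {m n : ℕ} (hmn : m * n ∣ 24) : 24 / n = m * (24 / (m * n)) := by
  have h0 : 0 < m * n := Nat.pos_of_dvd_of_pos hmn (by norm_num)
  apply Nat.div_eq_of_eq_mul_right (Nat.pos_of_mul_pos_left h0)
  rw [← mul_assoc, mul_comm n m, Nat.mul_div_cancel' hmn]

lemma weberGamma_le {m n : ℕ} (hmn : m * n ∣ 24) : weberGamma (m * n) ≤ weberGamma n := by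
  refine Subgroup.map_mono fun γ hγ i τ => ?_
  rw [div_eq_mul_div_mul hmn, pow_mul', pow_mul', hγ i τ]

lemma pow_coverExp_eq_of_mem_coverGroup {m e : ℕ} {c : Fin 3 → rootsOfUnity 24 ℂ}
    (hc : c ∈ coverGroup 24 ℂ) (hme : ∀ i, rootVal (c i) ^ (m * e) = 1) (i j : Fin 3) :
    (rootVal (c i) ^ e) ^ coverExp m = (rootVal (c j) ^ e) ^ coverExp m := by
  by_cases h3 : 3 ∣ m
  · -- The ratio `x = (c_i / c_j) ^ (e * coverExp m)` satisfies `x⁸ = 1` and `x³ = 1`.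
    have h8 : c i ^ 8 = c j ^ 8 := hc.2 i j
    have h1 (i : Fin 3) : ((rootVal (c i) ^ e) ^ coverExp m) ^ 3 = 1 := by
      rw [← pow_mul, ← pow_mul, ← hme i]
      nth_rw 2 [← three_mul_coverExp h3]
      congr 1
      ring
    have h9 (i : Fin 3) : (rootVal (c i) ^ e) ^ coverExp m * (rootVal (c i) ^ 8) ^ (e * coverExp m)
        = 1 := by
      rw [← one_pow 3, ← h1 i]
      ring
    have h := (h9 i).trans (h9 j).symm
    rw [← map_pow rootVal (c i) 8, h8, map_pow] at h
    exact mul_right_cancel₀ (right_ne_zero_of_mul_eq_one (h9 j)) h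
  · rw [coverExp_of_not_dvd h3, ← pow_mul', ← pow_mul', hme, hme]

variable {K : Type*} [Field K] [Algebra K ℂ] {ζ : K} {m n : ℕ}

lemma exists_coverGroup_of_mem_weberKernelSL (hζ : IsPrimitiveRoot ζ 24) (hmn : m * n ∣ 24)
    {γ : SL(2, ℤ)} (hγ : γ ∈ weberKernelSL n) :
    ∃ h ∈ coverGroup m K, ∀ i τ, weberU i (γ • τ) ^ (24 / (m * n)) =
      algebraMap K ℂ (rootVal (h i)) * weberU i τ ^ (24 / (m * n)) := by
  have hm : m ∣ 24 := (Dvd.intro n rfl).trans hmn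
  have : NeZero m := ⟨ne_zero_of_dvd_ne_zero (by norm_num) hm⟩
  obtain ⟨c, hc, hc1, hγc⟩ :=
    exists_weberU_smul_of_mem_weberKernelSL ((Dvd.intro_left m rfl).trans hmn) hγ
  rw [div_eq_mul_div_mul hmn] at hc1
  obtain ⟨h, hh, hhc⟩ := exists_mem_coverGroup_algebraMap_eq (L := ℂ)
    (hζ.pow (a := 24 / m) (by norm_num) (Nat.div_mul_cancel hm).symm)
    (c := fun i => rootVal (c i) ^ (24 / (m * n))) (fun i => by rw [← pow_mul', hc1])
    (by rw [Finset.prod_pow, ← map_prod, hc.1, map_one, one_pow])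
    (pow_coverExp_eq_of_mem_coverGroup hc hc1)
  exact ⟨h, hh, fun i τ => by rw [hγc, mul_pow, hhc]⟩

lemma exists_weberKernelSL_of_mem_coverGroup (hζ : IsPrimitiveRoot ζ 24) (hmn : m * n ∣ 24)
    {h : Fin 3 → rootsOfUnity m K} (hh : h ∈ coverGroup m K) :
    ∃ γ ∈ weberKernelSL n, ∀ i τ, weberU i (γ • τ) ^ (24 / (m * n)) =
      algebraMap K ℂ (rootVal (h i)) * weberU i τ ^ (24 / (m * n)) := by
  have hm : m ∣ 24 := (Dvd.intro n rfl).trans hmn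
  have : NeZero m := ⟨ne_zero_of_dvd_ne_zero (by norm_num) hm⟩
  set e := 24 / (m * n)
  have hpm : IsPrimitiveRoot (zeta 24 ^ (n * e)) m :=
    (zeta_isPrimitiveRoot (by norm_num)).pow (by norm_num)
      (by rw [mul_right_comm, ← mul_comm m, Nat.mul_div_cancel' hmn])
  have hval (p : rootsOfUnity m K) : ∃ s, zeta 24 ^ (n * e * s) = algebraMap K ℂ (rootVal p) := by
    obtain ⟨s, -, hs⟩ := hpm.eq_pow_of_pow_eq_one (ξ := algebraMap K ℂ (rootVal p))
      (by rw [← map_pow, rootVal_pow_eq_one, map_one])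
    exact ⟨s, by rw [pow_mul, hs]⟩
  obtain ⟨p, q, rfl⟩ := exists_eq_of_mem_coverGroup hm
    (hζ.pow (a := 24 / m) (by norm_num) (Nat.div_mul_cancel hm).symm) hh
  obtain ⟨s, hs⟩ := hval p
  obtain ⟨t, ht⟩ := hval q
  obtain ⟨γ, hγ⟩ := exists_weberU_smul_eq (n * s) (n * t)
  have hγe (i : Fin 3) (τ : ℍ) : weberU i (γ • τ) ^ e = algebraMap K ℂ
      (rootVal ((![p⁻¹, p⁻¹, p ^ 2] * ![q⁻¹, q ^ 2, q⁻¹] : Fin 3 → rootsOfUnity m K) i)) *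
        weberU i τ ^ e := by
    rw [hγ, mul_pow]
    congr 1
    fin_cases i <;> simp [map_inv, ← hs, ← ht] <;> ring
  refine ⟨γ, fun i τ => ?_, hγe⟩
  rw [div_eq_mul_div_mul hmn, pow_mul', hγe, mul_pow, ← map_pow, rootVal_pow_eq_one, map_one,
    one_mul, ← pow_mul']

lemma coverGroup_eq_of_weberU_smul_eq {e : ℕ} {h h' : coverGroup m K} {γ : SL(2, ℤ)}
    (hh : ∀ i τ, weberU i (γ • τ) ^ e = algebraMap K ℂ (rootVal (h.1 i)) * weberU i τ ^ e)
    (hh' : ∀ i τ, weberU i (γ • τ) ^ e = algebraMap K ℂ (rootVal (h'.1 i)) * weberU i τ ^ e) :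
    h = h' :=
  Subtype.ext <| funext fun i => algebraMap_rootVal_injective (L := ℂ) <|
    mul_right_cancel₀ (pow_ne_zero _ (weberU_ne_zero _ _))
      ((hh i UpperHalfPlane.I).symm.trans (hh' i UpperHalfPlane.I))

lemma exists_weberMultiplier (hζ : IsPrimitiveRoot ζ 24) (hmn : m * n ∣ 24) (g : weberGamma n) :
    ∃ h : coverGroup m K, ∀ γ : SL(2, ℤ), QuotientGroup.mk γ = g.1 → ∀ i τ,
      weberU i (γ • τ) ^ (24 / (m * n)) =
        algebraMap K ℂ (rootVal (h.1 i)) * weberU i τ ^ (24 / (m * n)) := by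
  obtain ⟨g, δ, hδ, rfl⟩ := g
  obtain ⟨h, hh, hhδ⟩ := exists_coverGroup_of_mem_weberKernelSL hζ hmn hδ
  exact ⟨⟨h, hh⟩, fun γ hγ i τ => by rw [smul_eq_of_mk_eq hγ, hhδ]⟩

/-- The homomorphism `Γ_n → coverGroup m K` sending `γ` to the triple `h` with
`𝔲_i^(24/(mn)) ∘ γ = h_i 𝔲_i^(24/(mn))`. -/
noncomputable def weberMultiplier (hζ : IsPrimitiveRoot ζ 24) (hmn : m * n ∣ 24) :
    weberGamma n →* coverGroup m K :=
  MonoidHom.mk' (fun g => (exists_weberMultiplier hζ hmn g).choose) fun g g' => by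
    have spec := fun g => (exists_weberMultiplier hζ hmn g).choose_spec
    obtain ⟨_, γ, hγ, rfl⟩ := g
    obtain ⟨_, δ, hδ, rfl⟩ := g'
    refine coverGroup_eq_of_weberU_smul_eq (spec _ (γ * δ) rfl) fun i τ => ?_
    rw [mul_smul, spec ⟨_, γ, hγ, rfl⟩ γ rfl, spec ⟨_, δ, hδ, rfl⟩ δ rfl, ← mul_assoc, ← map_mul,
      ← map_mul]
    rfl

lemma weberU_smul_pow (hζ : IsPrimitiveRoot ζ 24) (hmn : m * n ∣ 24) (γ : SL(2, ℤ))
    (hγ : (QuotientGroup.mk γ : PSL₂ℤ) ∈ weberGamma n) (i : Fin 3) (τ : ℍ) :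
    weberU i (γ • τ) ^ (24 / (m * n)) =
      algebraMap K ℂ (rootVal ((weberMultiplier hζ hmn ⟨QuotientGroup.mk γ, hγ⟩).1 i)) *
        weberU i τ ^ (24 / (m * n)) :=
  (exists_weberMultiplier hζ hmn ⟨_, hγ⟩).choose_spec γ rfl i τ

lemma weberMultiplier_surjective (hζ : IsPrimitiveRoot ζ 24) (hmn : m * n ∣ 24) :
    Function.Surjective (weberMultiplier hζ hmn) := by
  rintro ⟨h, hh⟩
  obtain ⟨γ, hγ, hγh⟩ := exists_weberKernelSL_of_mem_coverGroup hζ hmn hh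
  exact ⟨⟨_, γ, hγ, rfl⟩, coverGroup_eq_of_weberU_smul_eq
    (weberU_smul_pow hζ hmn γ (mk_mem_weberGamma.2 hγ)) hγh⟩

lemma ker_weberMultiplier (hζ : IsPrimitiveRoot ζ 24) (hmn : m * n ∣ 24) :
    (weberMultiplier hζ hmn).ker = (weberGamma (m * n)).subgroupOf (weberGamma n) := by
  ext ⟨_, γ, hγ, rfl⟩
  have spec := weberU_smul_pow hζ hmn γ (mk_mem_weberGamma.2 hγ)
  rw [MonoidHom.mem_ker, Subgroup.mem_subgroupOf]
  refine Iff.trans ⟨fun h i τ => ?_, fun h => ?_⟩ mk_mem_weberGamma.symm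
  · rw [spec, show weberMultiplier hζ hmn ⟨QuotientGroup.mk γ, _⟩ = 1 from h]
    simp
  · exact coverGroup_eq_of_weberU_smul_eq spec fun i τ => by simpa using h i τ

lemma exists_quotient_weberGamma_mulEquiv (hζ : IsPrimitiveRoot ζ 24) (hmn : m * n ∣ 24) :
    ∃ (_ : ((weberGamma (m * n)).subgroupOf (weberGamma n)).Normal)
      (θ : (weberGamma n ⧸ (weberGamma (m * n)).subgroupOf (weberGamma n)) ≃* coverGroup m K),
      ∀ (γ : SL(2, ℤ)) (hγ : (QuotientGroup.mk γ : PSL₂ℤ) ∈ weberGamma n) (i : Fin 3) (τ : ℍ),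
        weberU i (γ • τ) ^ (24 / (m * n)) =
          algebraMap K ℂ (rootVal ((θ (QuotientGroup.mk ⟨QuotientGroup.mk γ, hγ⟩)).1 i)) *
            weberU i τ ^ (24 / (m * n)) := by
  rw [← ker_weberMultiplier hζ hmn]
  exact ⟨inferInstance,
    QuotientGroup.quotientKerEquivOfSurjective _ (weberMultiplier_surjective hζ hmn),
    weberU_smul_pow hζ hmn⟩

end Multiplier

/-! ### Coordinate rings and integrality -/

section WeberPoints

lemma coverExp_ne_zero {N : ℕ} (hN : N ∣ 24) : coverExp N ≠ 0 := by
  have hN0 : N ≠ 0 := ne_zero_of_dvd_ne_zero (by norm_num) hN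
  unfold coverExp
  split_ifs <;> omega

lemma coverExp_dvd_eight {N : ℕ} (hN : N ∣ 24) : coverExp N ∣ 8 := by
  by_cases h3 : 3 ∣ N
  · rw [← three_mul_coverExp h3] at hN
    exact Nat.dvd_of_mul_dvd_mul_left (k := 3) (by norm_num) hN
  · rw [coverExp_of_not_dvd h3]
    exact dvd_eight_of_not_three_dvd hN h3

lemma not_three_dvd_of_mul_dvd {m n : ℕ} (h : m * n ∣ 24) (hm : 3 ∣ m) : ¬ 3 ∣ n := fun hn => by
  have := (Nat.mul_dvd_mul hm hn).trans h
  revert this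
  decide

lemma coverExp_mul {m n : ℕ} (h : m * n ∣ 24) :
    coverExp (m * n) = coverExp m * coverExp n := by
  unfold coverExp
  by_cases hm : 3 ∣ m
  · rw [if_pos (hm.mul_right n), if_pos hm, if_neg (not_three_dvd_of_mul_dvd h hm),
      Nat.div_mul_right_comm hm]
  · by_cases hn : 3 ∣ n
    · rw [if_pos (hn.mul_left m), if_neg hm, if_pos hn, Nat.mul_div_assoc m hn]
    · rw [if_neg (Nat.prime_three.not_dvd_mul hm hn), if_neg hm, if_neg hn]

lemma pow_coverExp_cube {M : Type*} [Monoid M] {N : ℕ} (h : 3 ∣ N) (x : M) :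
    (x ^ coverExp N) ^ 3 = x ^ N := by
  rw [← pow_mul, mul_comm, three_mul_coverExp h]

lemma pow_coverExp_eq_one {M : Type*} [Monoid M] {m n : ℕ} (h : m * n ∣ 24) {x : M}
    (hm : x ^ m = 1) (hx : x ^ coverExp (m * n) = 1) : x ^ coverExp m = 1 := by
  by_cases h3 : 3 ∣ m
  · have hgcd : Nat.gcd m (coverExp (m * n)) = coverExp m := by
      have hn := not_three_dvd_of_mul_dvd h h3
      nth_rw 1 [coverExp_mul h, coverExp_of_not_dvd hn, ← three_mul_coverExp h3, mul_comm,
        Nat.gcd_mul_left, (Nat.prime_three.coprime_iff_not_dvd.2 hn).gcd_eq_one, mul_one]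
    rw [← hgcd, pow_gcd_eq_one]
    exact ⟨hm, hx⟩
  · rwa [coverExp_of_not_dvd h3]

lemma pow_mul_self_of_cube_eq_one {M : Type*} [Monoid M] {k : ℕ} (hk : ¬ 3 ∣ k) {x : M}
    (hx : x ^ 3 = 1) : x ^ (k * k) = x := by
  have hmod : k * k % 3 = 1 := by
    rcases (by omega : k % 3 = 1 ∨ k % 3 = 2) with h | h <;> simp [Nat.mul_mod, h]
  rw [pow_eq_pow_mod _ hx, hmod, pow_one]

/-- The coefficient `s` of the first equation `X₀^e + X₁^e + X₂^e = s X₃^e` of the Weber curve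
`W_N`, with `e = coverExp N`. -/
def weberCoeff (N : ℕ) : ℕ := if 3 ∣ N then 0 else 48

lemma weberCoeff_mul_of_not_dvd {m : ℕ} (hm : ¬ 3 ∣ m) (n : ℕ) :
    weberCoeff (m * n) = weberCoeff n := by
  simp only [weberCoeff, Nat.prime_three.dvd_mul, hm, false_or]

variable {K : Type*} [Field K] {A B : Type*} [CommRing A] [CommRing B] [Algebra K A] [Algebra K B]
  {r : K} {m n N : ℕ}

lemma pow_eight_of_sq_eq_two (hr : r ^ 2 = 2) : r ^ 8 = 16 := by
  rw [show 8 = 2 * 4 from rfl, pow_mul, hr]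
  norm_num

lemma ne_zero_of_sq_eq_two [CharZero K] (hr : r ^ 2 = 2) : r ≠ 0 := by
  rintro rfl
  norm_num at hr

lemma weberConst_ne_zero [CharZero K] (hr : r ^ 2 = 2) (N : ℕ) : weberConst r N ≠ 0 := by
  have hr0 := ne_zero_of_sq_eq_two hr
  unfold weberConst
  split_ifs
  exacts [pow_ne_zero _ hr0, pow_ne_zero _ (mul_ne_zero two_ne_zero hr0)]

lemma weberConst_pow_coverExp (hr : r ^ 2 = 2) (h3 : 3 ∣ N) (hN : N ∣ 24) :
    weberConst r N ^ coverExp N = 16 := by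
  have h8 := coverExp_dvd_eight hN
  rw [coverExp, if_pos h3] at *
  rw [weberConst, if_pos h3, ← pow_mul, Nat.div_mul_cancel h8, pow_eight_of_sq_eq_two hr]

/-- The equations of the Weber curve `W_N` at the point `(x₀ : x₁ : x₂ : d)` with coordinates in a
`K`-algebra; affine points are those with `d = 1`. -/
def IsWeberPoint (r : K) (N : ℕ) (x : Fin 3 → A) (d : A) : Prop :=
  ∑ i, x i ^ coverExp N = weberCoeff N * d ^ coverExp N ∧
    ∏ i, x i = algebraMap K A (weberConst r N) * d ^ 3

lemma isWeberPoint_coord (r : K) (N : ℕ) : IsWeberPoint r N (coord r N) 1 := by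
  have h := coord_rel₁ r N
  refine ⟨?_, by rw [Fin.prod_univ_three, coord_rel₂, one_pow, mul_one]⟩
  unfold coverExp weberCoeff
  split_ifs at h ⊢ <;> simpa [Fin.sum_univ_three] using h

namespace IsWeberPoint

variable {x : Fin 3 → A} {d : A}

lemma map (hx : IsWeberPoint r N x d) (f : A →ₐ[K] B) :
    IsWeberPoint r N (fun i => f (x i)) (f d) := by
  constructor
  · simp only [← map_pow, ← map_sum, hx.1, map_mul, map_natCast]
  · simp only [← map_prod, hx.2, map_mul, map_pow, f.commutes]

lemma smul (hx : IsWeberPoint r N x d) (c : A) : IsWeberPoint r N (c • x) (c * d) := by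
  constructor
  · simp only [Pi.smul_apply, smul_eq_mul, mul_pow, ← Finset.mul_sum, hx.1]
    ring
  · simp only [Pi.smul_apply, smul_eq_mul, Finset.prod_mul_distrib, hx.2, Finset.prod_const,
      Finset.card_univ, Fintype.card_fin]
    ring

lemma comp_perm (hx : IsWeberPoint r N x d) (σ : Equiv.Perm (Fin 3)) :
    IsWeberPoint r N (x ∘ σ) d :=
  ⟨(Equiv.sum_comp σ fun i => x i ^ coverExp N).trans hx.1, (Equiv.prod_comp σ x).trans hx.2⟩

end IsWeberPoint

lemma sum_cube_eq {a : Fin 3 → A} (h : ∑ i, a i = 0) : ∑ i, a i ^ 3 = 3 * ∏ i, a i := by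
  simp only [Fin.sum_univ_three, Fin.prod_univ_three] at h ⊢
  linear_combination (a 0 ^ 2 + a 1 ^ 2 + a 2 ^ 2 - a 0 * a 1 - a 1 * a 2 - a 2 * a 0) * h

lemma isWeberPoint_iff_of_not_dvd (hm : ¬ 3 ∣ m) (h : m * n ∣ 24) {x : Fin 3 → A} {d : A} :
    IsWeberPoint r (m * n) x d ↔
      ∑ i, (x ^ m) i ^ coverExp n = weberCoeff n * (d ^ m) ^ coverExp n ∧
        ∏ i, x i = algebraMap K A (weberConst r (m * n)) * d ^ 3 := by
  simp only [IsWeberPoint, coverExp_mul h, coverExp_of_not_dvd hm, weberCoeff_mul_of_not_dvd hm,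
    pow_mul, Pi.pow_apply]

lemma isWeberPoint_iff_of_dvd (hN : 3 ∣ N) {x : Fin 3 → A} {d : A} :
    IsWeberPoint r N x d ↔ ∑ i, x i ^ coverExp N = 0 ∧
      ∏ i, x i = algebraMap K A (weberConst r N) * d ^ 3 := by
  simp only [IsWeberPoint, weberCoeff, if_pos hN, Nat.cast_zero, zero_mul]

lemma prod_pow_coverExp (hr : r ^ 2 = 2) (h3 : 3 ∣ N) (hN : N ∣ 24) {x : Fin 3 → A} {d : A}
    (hx : ∏ i, x i = algebraMap K A (weberConst r N) * d ^ 3) :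
    ∏ i, x i ^ coverExp N = 16 * d ^ N := by
  rw [Finset.prod_pow, hx, mul_pow, ← map_pow, weberConst_pow_coverExp hr h3 hN, map_ofNat,
    pow_right_comm, pow_coverExp_cube h3]

lemma sum_pow_coverExp_cube (hr : r ^ 2 = 2) (h : m * n ∣ 24) (hm : 3 ∣ m) {x : Fin 3 → A} {d : A}
    (hx : IsWeberPoint r n (x ^ m) (d ^ m))
    (hprod : ∏ i, x i = algebraMap K A (weberConst r (m * n)) * d ^ 3) :
    ∑ i, (x i ^ coverExp (m * n)) ^ 3 = 3 * ∏ i, x i ^ coverExp (m * n) := by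
  have hn := not_three_dvd_of_mul_dvd h hm
  have hmn := hm.mul_right n
  have hsum := hx.1
  simp only [coverExp_of_not_dvd hn, Pi.pow_apply, ← pow_mul, weberCoeff, if_neg hn] at hsum
  simp only [pow_coverExp_cube hmn, prod_pow_coverExp hr hmn h hprod, hsum]
  push_cast
  ring

lemma IsWeberPoint.pow (hr : r ^ 2 = 2) (h : m * n ∣ 24) {x : Fin 3 → A} {d : A}
    (hx : IsWeberPoint r (m * n) x d) : IsWeberPoint r n (x ^ m) (d ^ m) := by
  refine ⟨?_, ?_⟩
  · by_cases hm : 3 ∣ m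
    · have hn := not_three_dvd_of_mul_dvd h hm
      have hmn := hm.mul_right n
      rw [isWeberPoint_iff_of_dvd hmn] at hx
      have hcube := sum_cube_eq hx.1
      simp only [pow_coverExp_cube hmn, prod_pow_coverExp hr hmn h hx.2] at hcube
      simp only [weberCoeff, if_neg hn, coverExp_of_not_dvd hn, Pi.pow_apply, ← pow_mul, hcube]
      push_cast
      ring
    · exact ((isWeberPoint_iff_of_not_dvd hm h).1 hx).1
  · simp only [Pi.pow_apply, Finset.prod_pow, hx.2, mul_pow, ← map_pow, weberConst_pow hr h]
    rw [pow_right_comm]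

lemma IsWeberPoint.rootVal_mul (h : m * n ∣ 24) {x : Fin 3 → A} {d : A}
    (hx : IsWeberPoint r (m * n) x d) {g : Fin 3 → rootsOfUnity m K} (hg : g ∈ coverGroup m K) :
    IsWeberPoint r (m * n) (fun i => algebraMap K A (rootVal (g i)) * x i) d := by
  refine ⟨?_, ?_⟩
  · by_cases hm : 3 ∣ m
    · have hmn := hm.mul_right n
      have hpow (i : Fin 3) : g i ^ coverExp (m * n) = g 0 ^ coverExp (m * n) := by
        rw [coverExp_mul h, pow_mul, pow_mul, hg.2 i 0]
      rw [isWeberPoint_iff_of_dvd hmn] at hx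
      simp only [mul_pow, ← map_pow, hpow, ← Finset.mul_sum, hx.1, weberCoeff, if_pos hmn,
        Nat.cast_zero, mul_zero, zero_mul]
    · have hpow (i : Fin 3) : g i ^ coverExp (m * n) = 1 := by
        rw [coverExp_mul h, pow_mul, coverExp_of_not_dvd hm, rootsOfUnity_pow_eq_one, one_pow]
      simp only [mul_pow, ← map_pow, hpow, map_one, one_mul, hx.1]
  · rw [Finset.prod_mul_distrib, ← map_prod, ← map_prod, hg.1, map_one, map_one, one_mul, hx.2]

end WeberPoints

section Lifting

/-- The Lagrange resolvent `a₀ + θa₁ + θ²a₂` of the triple `a` at the cube root of unity `θ`. -/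
def lagrangeResolvent {R : Type*} [CommRing R] (θ : R) (a : Fin 3 → R) : R :=
  ∑ i : Fin 3, θ ^ (i : ℕ) * a i

lemma lagrangeResolvent_eq {R : Type*} [CommRing R] (θ : R) (a : Fin 3 → R) :
    lagrangeResolvent θ a = a 0 + θ * a 1 + θ ^ 2 * a 2 := by
  simp [lagrangeResolvent, Fin.sum_univ_three]

lemma lagrangeResolvent_mul_mul {R : Type*} [CommRing R] {ω : R} (hω : ω ^ 2 + ω + 1 = 0)
    (a : Fin 3 → R) :
    lagrangeResolvent 1 a * lagrangeResolvent ω a * lagrangeResolvent (ω ^ 2) a =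
      ∑ i, a i ^ 3 - 3 * ∏ i, a i := by
  have hω3 : ω ^ 3 = 1 := by linear_combination (ω - 1) * hω
  simp only [lagrangeResolvent_eq, Fin.sum_univ_three, Fin.prod_univ_three]
  linear_combination (a 0 + a 1 + a 2) * (a 1 ^ 2 + a 2 ^ 2 * (ω ^ 3 + 1) + a 1 * a 2 * ω +
    a 2 * ω * (a 0 + ω * a 1)) * hω3 +
      (a 0 + a 1 + a 2) * (a 0 * a 1 + a 0 * a 2 + a 1 * a 2) * hω

lemma exists_lagrangeResolvent_eq_zero {F : Type*} [Field F] [IsAlgClosed F] {a : Fin 3 → F}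
    (h : ∑ i, a i ^ 3 = 3 * ∏ i, a i) : ∃ θ : F, θ ^ 3 = 1 ∧ lagrangeResolvent θ a = 0 := by
  obtain ⟨ω, hω⟩ : ∃ ω : F, ω ^ 2 + ω + 1 = 0 := by
    obtain ⟨ω, hω⟩ := IsAlgClosed.exists_root
      (Polynomial.X ^ 2 + Polynomial.X + 1 : Polynomial F) (by
        rw [show Polynomial.degree _ = 2 by compute_degree!]
        norm_num)
    exact ⟨ω, by simpa using hω⟩
  have hω3 : ω ^ 3 = 1 := by linear_combination (ω - 1) * hω
  have hmul := lagrangeResolvent_mul_mul hω a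
  rw [h, sub_self, mul_eq_zero, mul_eq_zero] at hmul
  rcases hmul with (h0 | h0) | h0
  exacts [⟨1, one_pow 3, h0⟩, ⟨ω, hω3, h0⟩, ⟨ω ^ 2, by rw [pow_right_comm, hω3, one_pow], h0⟩]

section Twist

variable {K : Type*} [Field K] {A : Type*} [CommRing A] [Algebra K A] {r : K} {m N : ℕ}

lemma isWeberPoint_twist (hN : 3 ∣ N) {ψ : A} (hψ : ψ ^ 3 = 1) {x : Fin 3 → A} {d : A}
    (hsum : lagrangeResolvent (ψ ^ coverExp N) (fun i => x i ^ coverExp N) = 0)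
    (hprod : ∏ i, x i = algebraMap K A (weberConst r N) * d ^ 3) :
    IsWeberPoint r N (fun i => ψ ^ (i : ℕ) * x i) d := by
  refine (isWeberPoint_iff_of_dvd hN).2 ⟨?_, ?_⟩
  · simpa only [lagrangeResolvent, mul_pow, pow_right_comm _ _ (coverExp N)] using hsum
  · rw [Finset.prod_mul_distrib, hprod, Fin.prod_univ_three, ← pow_add, ← pow_add]
    exact (congrArg (· * _) hψ).trans (one_mul _)

lemma twist_pow (hm : 3 ∣ m) {ψ : A} (hψ : ψ ^ 3 = 1) (x : A) (k : ℕ) :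
    (ψ ^ k * x) ^ m = x ^ m := by
  rw [mul_pow, pow_right_comm, ← pow_coverExp_cube hm ψ, pow_right_comm ψ, hψ, one_pow, one_pow,
    one_mul]

end Twist

variable {F : Type*} [Field F]

lemma exists_pow_eq_one_mul_eq {x y : F} {m : ℕ} (hm : m ≠ 0) (h : x ^ m = y ^ m) :
    ∃ θ : F, θ ^ m = 1 ∧ θ * x = y := by
  rcases eq_or_ne x 0 with rfl | hx
  · rw [zero_pow hm, eq_comm, pow_eq_zero_iff hm] at h
    exact ⟨1, one_pow m, by rw [h, mul_zero]⟩
  · exact ⟨y / x, by rw [div_pow, ← h, div_self (pow_ne_zero _ hx)], div_mul_cancel₀ _ hx⟩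

lemma exists_pow_eq_prod_eq [IsAlgClosed F] {m : ℕ} (hm : m ≠ 0) {x : Fin 3 → F} {c : F}
    (h : ∏ i, x i = c ^ m) : ∃ y : Fin 3 → F, y ^ m = x ∧ ∏ i, y i = c := by
  choose y hy using fun i => IsAlgClosed.exists_pow_nat_eq (x i) (Nat.pos_of_ne_zero hm)
  obtain ⟨θ, hθ, hθc⟩ := exists_pow_eq_one_mul_eq hm
    (show (∏ i, y i) ^ m = c ^ m by simp only [← Finset.prod_pow, hy, h])
  refine ⟨![θ, 1, 1] * y, funext fun i => ?_, ?_⟩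
  · fin_cases i <;> simp [mul_pow, hθ, hy]
  · rw [← hθc]
    simp only [Fin.prod_univ_three, Pi.mul_apply, Matrix.cons_val]
    ring

variable {K : Type*} [Field K] [Algebra K F] {r : K} {m n : ℕ}

/-- For `3 ∣ m` the equation of `W_n` says that the `(mn/3)`-th powers `a` of the coordinates
satisfy `a₀³ + a₁³ + a₂³ = 3a₀a₁a₂`, of which `a₀ + a₁ + a₂` is a factor, up to twisting by a cube
root of unity. -/
lemma exists_isWeberPoint_pow_eq_of_three_dvd [IsAlgClosed F] (hr : r ^ 2 = 2) (h : m * n ∣ 24)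
    (hm : 3 ∣ m) {x : Fin 3 → F} {d : F} (hx : IsWeberPoint r n (x ^ m) (d ^ m))
    (hprod : ∏ i, x i = algebraMap K F (weberConst r (m * n)) * d ^ 3) :
    ∃ y, IsWeberPoint r (m * n) y d ∧ y ^ m = x ^ m := by
  have hmn := hm.mul_right n
  obtain ⟨θ, hθ, hsum⟩ := exists_lagrangeResolvent_eq_zero
    (sum_pow_coverExp_cube hr h hm hx hprod)
  obtain ⟨ψ, hψ, hψθ⟩ : ∃ ψ : F, ψ ^ 3 = 1 ∧ ψ ^ coverExp (m * n) = θ := by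
    refine ⟨θ ^ coverExp (m * n), by rw [pow_right_comm, hθ, one_pow], ?_⟩
    rw [← pow_mul]
    exact pow_mul_self_of_cube_eq_one (not_three_dvd_of_dvd_eight (coverExp_dvd_eight h)) hθ
  exact ⟨_, isWeberPoint_twist hmn hψ (hψθ.symm ▸ hsum) hprod, funext fun i => twist_pow hm hψ _ _⟩

theorem exists_isWeberPoint_pow_eq [IsAlgClosed F] (hr : r ^ 2 = 2) (h : m * n ∣ 24)
    {x : Fin 3 → F} {d : F} (hx : IsWeberPoint r n x d) :
    ∃ y δ, IsWeberPoint r (m * n) y δ ∧ y ^ m = x ∧ δ ^ m = d := by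
  have hm : m ≠ 0 := by rintro rfl; simp at h
  obtain ⟨δ, rfl⟩ := IsAlgClosed.exists_pow_nat_eq d (Nat.pos_of_ne_zero hm)
  obtain ⟨y, rfl, hprod⟩ := exists_pow_eq_prod_eq hm (x := x)
    (c := algebraMap K F (weberConst r (m * n)) * δ ^ 3) (by
      rw [hx.2, ← weberConst_pow hr h, map_pow, mul_pow, pow_right_comm])
  by_cases h3 : 3 ∣ m
  · obtain ⟨z, hz, hzy⟩ := exists_isWeberPoint_pow_eq_of_three_dvd hr h h3 hx hprod
    exact ⟨z, δ, hz, hzy, rfl⟩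
  · exact ⟨y, δ, (isWeberPoint_iff_of_not_dvd h3 h).2 ⟨hx.1, hprod⟩, rfl, rfl⟩

end Lifting

section CoordinateRing

variable {K : Type*} [Field K] {A : Type*} [CommRing A] [Algebra K A] {r : K} {m n N : ℕ}

/-- The homomorphism out of the coordinate ring of `W_N` given by an affine point of `W_N`. -/
noncomputable def weberLift (x : Fin 3 → A) (hx : IsWeberPoint r N x 1) : WeberRing r N →ₐ[K] A :=
  Ideal.Quotient.liftₐ (weberIdeal r N) (aeval x) (by
    suffices weberIdeal r N ≤ RingHom.ker (aeval (R := K) x) from fun a ha => this ha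
    obtain ⟨hsum, hprod⟩ := hx
    rw [weberIdeal, Ideal.span_le]
    rintro _ (rfl | rfl) <;> rw [SetLike.mem_coe, RingHom.mem_ker]
    · have h48 : algebraMap K A 48 = 48 := map_ofNat _ 48
      simp only [coverExp, weberCoeff, Fin.sum_univ_three] at hsum
      split_ifs at hsum with h3 <;>
        simpa [weberForm₁, dehomogenize, h3, sub_eq_zero, h48] using hsum
    · simpa [weberForm₂, dehomogenize, sub_eq_zero, Fin.prod_univ_three] using hprod)

@[simp]
lemma weberLift_coord (x : Fin 3 → A) (hx : IsWeberPoint r N x 1) (i : Fin 3) :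
    weberLift x hx (coord r N i) = x i :=
  aeval_X x i

@[simp]
lemma pullback_coord (hr : r ^ 2 = 2) (h : m * n ∣ 24) (i : Fin 3) :
    pullback hr h (coord r n i) = coord r (m * n) i ^ m :=
  aeval_X _ i

lemma weberRing_algHom_ext {f g : WeberRing r N →ₐ[K] A}
    (h : ∀ i, f (coord r N i) = g (coord r N i)) : f = g :=
  Ideal.Quotient.algHom_ext _ (MvPolynomial.algHom_ext h)

lemma isUnit_coord [CharZero K] (hr : r ^ 2 = 2) (N : ℕ) (i : Fin 3) : IsUnit (coord r N i) := by
  have h : IsUnit (∏ i, coord r N i) := by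
    rw [(isWeberPoint_coord r N).2, one_pow, mul_one]
    exact (weberConst_ne_zero hr N).isUnit.map _
  exact isUnit_of_dvd_unit (Finset.dvd_prod_of_mem _ (Finset.mem_univ i)) h

lemma weberRing_algHom_ext_of_coord_zero_one [CharZero K] (hr : r ^ 2 = 2)
    {f g : WeberRing r N →ₐ[K] A} (h₀ : f (coord r N 0) = g (coord r N 0))
    (h₁ : f (coord r N 1) = g (coord r N 1)) : f = g := by
  have h₂ : f (coord r N 2) = g (coord r N 2) := by
    refine (((isUnit_coord hr N 0).mul (isUnit_coord hr N 1)).map f).mul_left_cancel ?_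
    nth_rw 2 [map_mul]
    rw [h₀, h₁, ← map_mul, ← map_mul, ← map_mul, coord_rel₂, f.commutes, g.commutes]
  refine weberRing_algHom_ext fun i => ?_
  fin_cases i
  exacts [h₀, h₁, h₂]

end CoordinateRing

section Irreducible

lemma irreducible_X_pow_add_C_of_prime {R : Type*} [CommRing R] [IsDomain R] {p a : R}
    (hp : Prime p) (hpa : p ∣ a) (hpa2 : ¬ p ^ 2 ∣ a) {n : ℕ} (hn : 0 < n) :
    Irreducible (Polynomial.X ^ n + Polynomial.C a) := by
  have hmonic : (Polynomial.X ^ n + Polynomial.C a).Monic :=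
    Polynomial.monic_X_pow_add_C a hn.ne'
  have hdeg : (Polynomial.X ^ n + Polynomial.C a).natDegree = n :=
    Polynomial.natDegree_X_pow_add_C
  have hprime := (Ideal.span_singleton_prime hp.ne_zero).2 hp
  refine Polynomial.IsEisensteinAt.irreducible ⟨?_, fun {i} hi => ?_, ?_⟩ hprime
    hmonic.isPrimitive (by rwa [hdeg])
  · rw [hmonic.leadingCoeff]
    exact (Ideal.ne_top_iff_one _).1 hprime.ne_top
  · rw [hdeg] at hi
    rw [Ideal.mem_span_singleton, Polynomial.coeff_add, Polynomial.coeff_X_pow, if_neg hi.ne,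
      Polynomial.coeff_C, zero_add]
    split_ifs
    exacts [hpa, dvd_zero p]
  · simpa [Ideal.span_singleton_pow, Ideal.mem_span_singleton, hn.ne] using hpa2

lemma exists_prime_dvd_mul_not_sq_dvd_mul {R : Type*} [CommRing R] [IsDomain R]
    [UniqueFactorizationMonoid R] {f g : R} (hf : Squarefree f) (hf' : ¬ IsUnit f)
    (hfg : IsCoprime f g) : ∃ p, Prime p ∧ p ∣ g * f ∧ ¬ p ^ 2 ∣ g * f := by
  obtain ⟨p, hp, hpf⟩ := WfDvdMonoid.exists_irreducible_factor hf' hf.ne_zero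
  have hpg : ¬ p ∣ g := fun hpg => hp.not_isUnit (hfg.isUnit_of_dvd' hpf hpg)
  refine ⟨p, hp.prime, hpf.mul_left g, fun hsq => hp.not_isUnit (hf p ?_)⟩
  rw [← sq]
  exact hp.prime.pow_dvd_of_dvd_mul_left 2 hpg hsq

variable {K : Type*} [Field K]

/-- The equation `Y²⁴ + u⁸(u⁸ + 1) / 16 = 0` satisfied by `u = x₁ / x₀` and `Y = 1 / x₀` on the
Weber curve `W₂₄`, as a polynomial in `Y` over `K[u]`. -/
noncomputable def weberModel (K : Type*) [Field K] : Polynomial (Polynomial K) :=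
  Polynomial.X ^ 24 +
    Polynomial.C (Polynomial.C (1 / 16) * (Polynomial.X ^ 8 * (Polynomial.X ^ 8 + 1)))

/-- The ring `K[u, Y, (uY)⁻¹]` of functions on the locus `uY ≠ 0` of the affine plane curve with
equation `weberModel K`; it is isomorphic to the coordinate ring of `W₂₄`. -/
abbrev WeberModelRing (K : Type*) [Field K] : Type _ :=
  Localization.Away (AdjoinRoot.of (weberModel K) Polynomial.X * AdjoinRoot.root (weberModel K))

lemma exists_units_weberModelRing : ∃ u y : (WeberModelRing K)ˣ,
    ↑u = algebraMap _ (WeberModelRing K) (AdjoinRoot.of (weberModel K) Polynomial.X) ∧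
    ↑y = algebraMap _ (WeberModelRing K) (AdjoinRoot.root (weberModel K)) ∧
    (weberModel K).eval₂ (Polynomial.aeval (R := K) (u : WeberModelRing K))
      (y : WeberModelRing K) = 0 := by
  let ι := algebraMap (AdjoinRoot (weberModel K)) (WeberModelRing K)
  obtain ⟨⟨u, hu⟩, y, hy⟩ : IsUnit (ι (AdjoinRoot.of _ Polynomial.X)) ∧
      IsUnit (ι (AdjoinRoot.root _)) := by
    rw [← IsUnit.mul_iff, ← map_mul]
    exact IsLocalization.Away.algebraMap_isUnit _
  have haeval : Polynomial.aeval (R := K) (u : WeberModelRing K) =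
      (IsScalarTower.toAlgHom K _ (WeberModelRing K)).comp (AdjoinRoot.ofAlgHom K _) :=
    Polynomial.algHom_ext (by rw [Polynomial.aeval_X, hu]; rfl)
  refine ⟨u, y, hu, hy, ?_⟩
  rw [haeval, hy]
  exact (Polynomial.hom_eval₂ _ _ ι _).symm.trans
    ((congrArg ι (AdjoinRoot.eval₂_root _)).trans (map_zero ι))

variable {A : Type*} [CommRing A] [Algebra K A] {r : K}

/-- The homomorphism out of the coordinate ring of the plane model of `W₂₄` given by a point of
that model with invertible coordinates. -/
noncomputable def weberModelLift (u y : Aˣ)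
    (h : (weberModel K).eval₂ (Polynomial.aeval (R := K) (u : A)) (y : A) = 0) :
    WeberModelRing K →ₐ[K] A :=
  IsLocalization.liftAlgHom
    (M := .powers (AdjoinRoot.of (weberModel K) Polynomial.X * AdjoinRoot.root (weberModel K)))
    (f := AdjoinRoot.liftAlgHom (weberModel K) (Polynomial.aeval (u : A)) (y : A) h) (by
      rintro ⟨_, k, rfl⟩
      simpa using ((u * y) ^ k).isUnit)

variable [CharZero K]

lemma irreducible_weberModel : Irreducible (weberModel K) := by
  have hsep : (Polynomial.X ^ 8 + 1 : Polynomial K).Separable := by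
    simpa using Polynomial.separable_X_pow_sub_C (n := 8) (-1 : K) (by norm_num) (by norm_num)
  have hunit : ¬ IsUnit (Polynomial.X ^ 8 + 1 : Polynomial K) := fun h => by
    have := Polynomial.natDegree_eq_zero_of_isUnit h
    rw [← Polynomial.C_1, Polynomial.natDegree_X_pow_add_C] at this
    norm_num at this
  obtain ⟨p, hp, hdvd, hsq⟩ := exists_prime_dvd_mul_not_sq_dvd_mul hsep.squarefree hunit
    (show IsCoprime _ (Polynomial.X ^ 8) from ⟨1, -1, by ring⟩)
  have h16 : IsUnit (Polynomial.C (1 / 16 : K)) := Polynomial.isUnit_C.2 (by norm_num)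
  exact irreducible_X_pow_add_C_of_prime hp (hdvd.mul_left _) (by rwa [h16.dvd_mul_left])
    (by norm_num)

lemma eval₂_weberModel_eq_zero_iff (f : Polynomial K →ₐ[K] A) (y : A) :
    (weberModel K).eval₂ f y = 0 ↔
      16 * y ^ 24 + f Polynomial.X ^ 8 * (f Polynomial.X ^ 8 + 1) = 0 := by
  have h16 : IsUnit (algebraMap K A 16) := (isUnit_iff_ne_zero.2 (by norm_num)).map _
  have hinv : algebraMap K A 16 * algebraMap K A (1 / 16) = 1 := by
    rw [← map_mul]
    norm_num
  have heval : (weberModel K).eval₂ f y = y ^ 24 +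
      algebraMap K A (1 / 16) * (f Polynomial.X ^ 8 * (f Polynomial.X ^ 8 + 1)) := by
    have hC : f (Polynomial.C (1 / 16)) = algebraMap K A (1 / 16) := f.commutes _
    rw [weberModel, Polynomial.eval₂_add, Polynomial.eval₂_X_pow, Polynomial.eval₂_C]
    simp only [RingHom.coe_coe, map_mul, map_add, map_pow, map_one, hC]
  rw [← h16.mul_right_eq_zero, heval, mul_add, ← mul_assoc, hinv, one_mul, map_ofNat]

lemma IsWeberPoint.eval₂_weberModel (hr : r ^ 2 = 2) {x : Fin 3 → A} (hx : IsWeberPoint r 24 x 1)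
    {y : A} (hy : y * x 0 = 1) :
    (weberModel K).eval₂ (Polynomial.aeval (R := K) (x 1 * y)) y = 0 := by
  rw [eval₂_weberModel_eq_zero_iff, Polynomial.aeval_X]
  have h24 : coverExp 24 = 8 := by decide
  have hprod := prod_pow_coverExp hr (by norm_num) dvd_rfl hx.2
  have hsum := ((isWeberPoint_iff_of_dvd (by norm_num)).1 hx).1
  simp only [h24, Fin.sum_univ_three, Fin.prod_univ_three, one_pow, mul_one] at hsum hprod
  have hy8 : y ^ 8 * x 0 ^ 8 = 1 := by rw [← mul_pow, hy, one_pow]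
  rw [mul_pow, show y ^ 24 = (y ^ 8) ^ 3 by ring]
  generalize y ^ 8 = w at *
  generalize x 0 ^ 8 = a at *
  generalize x 1 ^ 8 = b at *
  generalize x 2 ^ 8 = c at *
  linear_combination -w ^ 3 * hprod + (w ^ 2 * b * c - b * w) * hy8 + b * w ^ 2 * hsum

lemma isWeberPoint_of_eval₂_weberModel (hr : r ^ 2 = 2) {u y : Aˣ}
    (h : (weberModel K).eval₂ (Polynomial.aeval (R := K) (u : A)) (y : A) = 0) :
    IsWeberPoint r 24 ![↑y⁻¹, ↑(u * y⁻¹), algebraMap K A r * ↑(y ^ 2 * u⁻¹)] 1 := by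
  have h24 : coverExp 24 = 8 := by decide
  constructor
  · have h16 : algebraMap K A r ^ 8 = 16 := by
      rw [← map_pow, pow_eight_of_sq_eq_two hr, map_ofNat]
    rw [eval₂_weberModel_eq_zero_iff, Polynomial.aeval_X] at h
    simp only [h24, Fin.sum_univ_three, Matrix.cons_val, mul_pow, h16, weberCoeff,
      if_pos (show 3 ∣ 24 by norm_num), Nat.cast_zero, zero_mul]
    have hy : ((y⁻¹ : Aˣ) : A) ^ 8 * y ^ 8 = 1 := by rw [← mul_pow, y.inv_mul, one_pow]
    have hu1 : ((u⁻¹ : Aˣ) : A) ^ 8 * u ^ 8 = 1 := by rw [← mul_pow, u.inv_mul, one_pow]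
    push_cast
    linear_combination (y⁻¹ : Aˣ) ^ 8 * (u⁻¹ : Aˣ) ^ 8 * h - (y⁻¹ : Aˣ) ^ 8 * (u ^ 8 + 1) * hu1 -
      16 * y ^ 16 * (u⁻¹ : Aˣ) ^ 8 * hy
  · have hconst : weberConst r 24 = r := by norm_num [weberConst]
    have hone : y⁻¹ * (u * y⁻¹) * (y ^ 2 * u⁻¹) = 1 := by
      simp [mul_left_comm, sq]
    simp only [Fin.prod_univ_three, Matrix.cons_val, hconst, one_pow, mul_one]
    rw [mul_left_comm, ← Units.val_mul, ← Units.val_mul, hone, Units.val_one, mul_one]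

lemma isDomain_weberModelRing : IsDomain (WeberModelRing K) := by
  have hdeg : (weberModel K).natDegree = 24 := Polynomial.natDegree_X_pow_add_C
  have hmonic : (weberModel K).Monic := Polynomial.monic_X_pow_add_C _ (by norm_num)
  have := AdjoinRoot.isDomain_of_prime (irreducible_weberModel (K := K)).prime
  have hu : AdjoinRoot.of (weberModel K) Polynomial.X ≠ 0 := by
    rw [← AdjoinRoot.mk_C]
    exact AdjoinRoot.mk_ne_zero_of_natDegree_lt hmonic
      (Polynomial.C_ne_zero.2 Polynomial.X_ne_zero) (by simp [hdeg])
  have hy : AdjoinRoot.root (weberModel K) ≠ 0 := by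
    rw [← AdjoinRoot.mk_X]
    exact AdjoinRoot.mk_ne_zero_of_natDegree_lt hmonic Polynomial.X_ne_zero (by simp [hdeg])
  exact IsLocalization.isDomain_localization
    (powers_le_nonZeroDivisors_of_noZeroDivisors (mul_ne_zero hu hy))

theorem isDomain_weberRing_twentyFour (hr : r ^ 2 = 2) : IsDomain (WeberRing r 24) := by
  have hdom := isDomain_weberModelRing (K := K)
  obtain ⟨u, y, hu, hy, hroot⟩ := exists_units_weberModelRing (K := K)
  obtain ⟨a, ha⟩ := isUnit_coord hr 24 0
  obtain ⟨b, hb⟩ := isUnit_coord hr 24 1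
  let φ := weberLift _ (isWeberPoint_of_eval₂_weberModel hr hroot)
  let θ := weberModelLift (K := K) (b * a⁻¹) a⁻¹ (by
    rw [Units.val_mul, hb]
    exact (isWeberPoint_coord r 24).eval₂_weberModel hr (by rw [← ha, a.inv_mul]))
  have hθu : Units.map θ u = b * a⁻¹ := Units.ext (by simp [θ, weberModelLift, hu])
  have hθy : Units.map θ y = a⁻¹ := Units.ext (by simp [θ, weberModelLift, hy])
  have hunits (g : (WeberModelRing K)ˣ) : θ g = Units.map (θ : _ →* WeberRing r 24) g := rfl
  have hθφ : θ.comp φ = AlgHom.id K _ := by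
    refine weberRing_algHom_ext_of_coord_zero_one hr ?_ ?_ <;>
      simp only [φ, AlgHom.comp_apply, AlgHom.id_apply, weberLift_coord, Matrix.cons_val]
    · rw [hunits, map_inv, hθy, inv_inv, ha]
    · rw [hunits, map_mul, map_inv, hθy, hθu, inv_inv, inv_mul_cancel_right, hb]
  have hinj : Function.Injective φ :=
    Function.LeftInverse.injective (g := θ) fun f => DFunLike.congr_fun hθφ f
  exact hinj.isDomain φ.toRingHom

end Irreducible

section FibreEquation

variable {K : Type*} [Field K] {Λ : Type*} [CommRing Λ] [Algebra K Λ]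
  {A : Type*} [CommRing A] [Algebra K A] {r : K} {N : ℕ}

/-- The monic equation of `x₁` over `K[x₀, x₀⁻¹]` on the affine Weber curve `W_N`, obtained from
`x₀^e + x₁^e + x₂^e = s` and `x₀x₁x₂ = d` by eliminating `x₂`, with `x₀` specialised to `t`. -/
noncomputable def fibrePoly (r : K) (N : ℕ) (t : Λˣ) : Polynomial Λ :=
  Polynomial.X ^ (coverExp N + coverExp N) +
    (Polynomial.C (t ^ coverExp N - weberCoeff N : Λ) * Polynomial.X ^ coverExp N +
      Polynomial.C (algebraMap K Λ (weberConst r N) ^ coverExp N * (t⁻¹ ^ coverExp N : Λˣ)))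

lemma monic_fibrePoly (hN : N ∣ 24) (t : Λˣ) : (fibrePoly r N t).Monic := by
  have he := coverExp_ne_zero hN
  nontriviality Λ
  refine Polynomial.monic_X_pow_add (lt_of_le_of_lt (b := (coverExp N : WithBot ℕ)) ?_ ?_)
  · compute_degree
    exact le_rfl
  · exact_mod_cast Nat.lt_add_of_pos_left (Nat.pos_of_ne_zero he)

lemma pow_mul_eval₂_fibrePoly (f : Λ →ₐ[K] A) (t : Λˣ) (y : A) :
    f t ^ coverExp N * (fibrePoly r N t).eval₂ f y =
      f t ^ coverExp N * y ^ coverExp N * (f t ^ coverExp N + y ^ coverExp N - weberCoeff N) +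
        algebraMap K A (weberConst r N) ^ coverExp N := by
  have ht : f t * f ↑t⁻¹ = 1 := by rw [← map_mul, t.mul_inv, map_one]
  rw [fibrePoly, Polynomial.eval₂_add, Polynomial.eval₂_X_pow, Polynomial.eval₂_add,
    Polynomial.eval₂_mul, Polynomial.eval₂_X_pow, Polynomial.eval₂_C, Polynomial.eval₂_C]
  simp only [RingHom.coe_coe, map_sub, map_mul, map_pow, map_natCast, f.commutes,
    Units.val_pow_eq_pow_val, pow_add]
  have hte : f t ^ coverExp N * f ↑t⁻¹ ^ coverExp N = 1 := by rw [← mul_pow, ht, one_pow]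
  linear_combination algebraMap K A (weberConst r N) ^ coverExp N * hte

lemma IsWeberPoint.eval₂_fibrePoly {x : Fin 3 → A} (hx : IsWeberPoint r N x 1) {f : Λ →ₐ[K] A}
    {t : Λˣ} (ht : f t = x 0) : (fibrePoly r N t).eval₂ f (x 1) = 0 := by
  have hunit : IsUnit (f t ^ coverExp N) := (t.isUnit.map f).pow _
  obtain ⟨hsum, hprod⟩ := hx
  simp only [Fin.sum_univ_three, Fin.prod_univ_three, one_pow, mul_one] at hsum hprod
  rw [← hunit.mul_right_eq_zero, pow_mul_eval₂_fibrePoly, ht, ← hprod]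
  linear_combination x 0 ^ coverExp N * x 1 ^ coverExp N * hsum

lemma exists_isWeberPoint_of_eval₂_fibrePoly [CharZero K] (hr : r ^ 2 = 2) (hN : N ∣ 24)
    {f : Λ →ₐ[K] A} {t : Λˣ} {y : A} (h : (fibrePoly r N t).eval₂ f y = 0) :
    ∃ x, IsWeberPoint r N x 1 ∧ x 0 = f t ∧ x 1 = y := by
  have he := coverExp_ne_zero hN
  have hd : IsUnit (algebraMap K A (weberConst r N)) := (weberConst_ne_zero hr N).isUnit.map _
  have hmul := pow_mul_eval₂_fibrePoly (r := r) (N := N) f t y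
  rw [h, mul_zero] at hmul
  have hunit : IsUnit ((f t * y) ^ coverExp N) := by
    refine isUnit_of_dvd_unit
      ⟨-(f t ^ coverExp N + y ^ coverExp N - weberCoeff N), ?_⟩ (hd.pow (coverExp N))
    linear_combination -hmul
  obtain ⟨v, hv⟩ := (isUnit_pow_iff he).1 hunit
  have hv1 : f t * y * (v⁻¹ : Aˣ) = 1 := by rw [← hv, v.mul_inv]
  have hve : f t ^ coverExp N * y ^ coverExp N * (v⁻¹ : Aˣ) ^ coverExp N = 1 := by
    rw [← mul_pow, ← mul_pow, hv1, one_pow]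
  refine ⟨![f t, y, algebraMap K A (weberConst r N) * (v⁻¹ : Aˣ)], ⟨?_, ?_⟩, rfl, rfl⟩
  · simp only [Fin.sum_univ_three, Matrix.cons_val, mul_pow, one_pow, mul_one]
    linear_combination -(v⁻¹ : Aˣ) ^ coverExp N * hmul -
      (f t ^ coverExp N + y ^ coverExp N - weberCoeff N) * hve
  · simp only [Fin.prod_univ_three, Matrix.cons_val, one_pow, mul_one]
    linear_combination algebraMap K A (weberConst r N) * hv1

/-- Evaluation of Laurent polynomials at a unit. -/
noncomputable def laurentLift (u : Aˣ) : LaurentPolynomial K →ₐ[K] A :=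
  AddMonoidAlgebra.lift K A ℤ ((Units.coeHom A).comp (zpowersHom Aˣ u))

lemma laurentLift_T_one (u : Aˣ) : laurentLift (K := K) u (LaurentPolynomial.T 1) = u :=
  (AddMonoidAlgebra.lift_single _ _ _).trans (by simp)

theorem eq_zero_of_aeval_coord_zero_mul_eq_zero [CharZero K] (hr : r ^ 2 = 2) (hN : N ∣ 24)
    {p : Polynomial K} (hp : p ≠ 0) {f : WeberRing r N}
    (h : Polynomial.aeval (coord r N 0) p * f = 0) : f = 0 := by
  let t : (LaurentPolynomial K)ˣ := (LaurentPolynomial.isUnit_T 1).unit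
  let q := fibrePoly r N t
  have := (monic_fibrePoly (r := r) hN t).free_adjoinRoot
  obtain ⟨u, hu⟩ := isUnit_coord hr N 0
  obtain ⟨x, hx, hx₀, hx₁⟩ := exists_isWeberPoint_of_eval₂_fibrePoly hr hN
    (f := AdjoinRoot.ofAlgHom K q) (AdjoinRoot.eval₂_root q)
  let φ := weberLift x hx
  let θ : AdjoinRoot q →ₐ[K] WeberRing r N := AdjoinRoot.liftAlgHom q (laurentLift u) (coord r N 1)
    ((isWeberPoint_coord r N).eval₂_fibrePoly ((laurentLift_T_one u).trans hu))
  have hθφ : θ.comp φ = AlgHom.id K _ := by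
    refine weberRing_algHom_ext_of_coord_zero_one hr ?_ ?_ <;>
      simp [φ, θ, hx₀, hx₁, t, laurentLift_T_one, hu]
  have hinj : Function.Injective φ :=
    Function.LeftInverse.injective (g := θ) fun f => DFunLike.congr_fun hθφ f
  have hφ : Polynomial.toLaurent p • φ f = 0 := by
    have hcomp : φ.comp (Polynomial.aeval (coord r N 0)) =
        (AdjoinRoot.ofAlgHom K q).comp Polynomial.toLaurentAlg :=
      Polynomial.algHom_ext (by simp [φ, hx₀, t])
    rw [← map_zero φ, ← h, map_mul, Algebra.smul_def]
    exact congrArg (· * φ f) (DFunLike.congr_fun hcomp p).symm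
  exact (map_eq_zero_iff φ hinj).1
    ((smul_eq_zero.1 hφ).resolve_left ((map_ne_zero_iff _ Polynomial.toLaurent_injective).2 hp))

end FibreEquation

section PullbackInjective

universe u

lemma exists_injective_pow_eq (K : Type*) {A : Type u} [Field K] [CommRing A] [Algebra K A] (a : A)
    {m : ℕ} (hm : m ≠ 0) :
    ∃ (S : Type u) (_ : CommRing S) (_ : Algebra K S) (φ : A →ₐ[K] S) (y : S),
      Function.Injective φ ∧ y ^ m = φ a := by
  let p : Polynomial A := Polynomial.X ^ m - Polynomial.C a
  refine ⟨AdjoinRoot p, inferInstance, inferInstance, AdjoinRoot.ofAlgHom K p, AdjoinRoot.root p,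
    ?_, ?_⟩
  · refine (injective_iff_map_eq_zero _).2 fun b hb => by_contra fun hb0 => ?_
    have := nontrivial_of_ne b 0 hb0
    refine AdjoinRoot.mk_ne_zero_of_natDegree_lt (Polynomial.monic_X_pow_sub_C a hm)
      (Polynomial.C_ne_zero.2 hb0) ?_ hb
    rw [Polynomial.natDegree_C, Polynomial.natDegree_X_pow_sub_C]
    exact Nat.pos_of_ne_zero hm
  · have h := AdjoinRoot.eval₂_root p
    rwa [Polynomial.eval₂_sub, Polynomial.eval₂_X_pow, Polynomial.eval₂_C, sub_eq_zero] at h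

variable {K : Type*} [Field K] {r : K} {m n : ℕ}

lemma exists_injective_pow_eq_prod_eq {A : Type u} [CommRing A] [Algebra K A] (hm : m ≠ 0)
    {x : Fin 3 → A} {c : K} (hc : c ≠ 0) (h : ∏ i, x i = algebraMap K A (c ^ m)) :
    ∃ (S : Type u) (_ : CommRing S) (_ : Algebra K S) (φ : A →ₐ[K] S) (y : Fin 3 → S),
      Function.Injective φ ∧ (∀ i, y i ^ m = φ (x i)) ∧ ∏ i, y i = algebraMap K S c := by
  obtain ⟨S, _, _, φ, a, hφ, ha⟩ := exists_injective_pow_eq K (x 0) hm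
  obtain ⟨T, _, _, ψ, b, hψ, hb⟩ := exists_injective_pow_eq K (φ (x 1)) hm
  have hab : (ψ a * b) ^ m = ψ (φ (x 0 * x 1)) := by
    rw [mul_pow, ← map_pow, ha, hb, map_mul, map_mul]
  have hprod : ψ (φ (x 0 * x 1)) * ψ (φ (x 2)) = algebraMap K T c ^ m := by
    rw [← map_mul, ← map_mul, ← Fin.prod_univ_three, h, φ.commutes, ψ.commutes, map_pow]
  obtain ⟨u, hu⟩ : IsUnit (ψ a * b) := by
    rw [← isUnit_pow_iff hm, hab]
    exact isUnit_of_mul_isUnit_left (hprod ▸ (hc.isUnit.map (algebraMap K T)).pow m)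
  refine ⟨T, _, _, ψ.comp φ, ![ψ a, b, algebraMap K T c * ↑u⁻¹], hψ.comp hφ, fun i => ?_, ?_⟩
  · fin_cases i
    · exact (map_pow ψ a m).symm.trans (congrArg ψ ha)
    · exact hb
    · refine (u.isUnit.pow m).mul_left_cancel ?_
      simp only [Fin.reduceFinMk, Matrix.cons_val, AlgHom.comp_apply]
      rw [← mul_pow, mul_left_comm, u.mul_inv, mul_one, ← hprod, ← hab, hu]
  · rw [Fin.prod_univ_three]
    simp only [Matrix.cons_val]
    rw [← hu, mul_left_comm, u.mul_inv, mul_one]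

lemma lagrangeResolvent_dvd_of_pullback_eq_zero (hr : r ^ 2 = 2) (h : m * n ∣ 24) (hm : 3 ∣ m)
    {S : Type*} [CommRing S] [Algebra K S] {φ : WeberRing r n →ₐ[K] S} {y : Fin 3 → S}
    (hy : ∀ i, y i ^ m = φ (coord r n i)) (hprod : ∏ i, y i = algebraMap K S (weberConst r (m * n)))
    {ψ : S} (hψ : ψ ^ 3 = 1) {f : WeberRing r n} (hf : pullback hr h f = 0) :
    lagrangeResolvent (ψ ^ coverExp (m * n)) (fun i => y i ^ coverExp (m * n)) ∣ φ f := by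
  set s := lagrangeResolvent (ψ ^ coverExp (m * n)) (fun i => y i ^ coverExp (m * n)) with hs
  let q := Ideal.Quotient.mkₐ K (Ideal.span {s})
  have hsum : q s = 0 := Ideal.Quotient.eq_zero_iff_mem.2 (Ideal.mem_span_singleton_self s)
  have hpoint : IsWeberPoint r (m * n) (fun i => q ψ ^ (i : ℕ) * q (y i)) 1 := by
    refine isWeberPoint_twist (hm.mul_right n) (by rw [← map_pow, hψ, map_one]) ?_ ?_
    · simpa [hs, lagrangeResolvent] using hsum
    · rw [← map_prod, hprod, q.commutes, one_pow, mul_one]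
  have hcomp : (weberLift _ hpoint).comp (pullback hr h) = q.comp φ :=
    weberRing_algHom_ext fun i => by
      simp [twist_pow hm (show q ψ ^ 3 = 1 by rw [← map_pow, hψ, map_one]), ← hy]
  have hqf : q (φ f) = 0 := by
    rw [← AlgHom.comp_apply, ← hcomp, AlgHom.comp_apply, hf, map_zero]
  exact Ideal.mem_span_singleton.1 (Ideal.Quotient.eq_zero_iff_mem.1 hqf)

lemma lagrangeResolvent_mul_add {R : Type*} [CommRing R] {ω : R} (hω : ω ^ 2 + ω + 1 = 0)
    (a : Fin 3 → R) :
    lagrangeResolvent ω a * lagrangeResolvent (ω ^ 2) a +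
      lagrangeResolvent 1 a * lagrangeResolvent (ω ^ 2) a +
      lagrangeResolvent 1 a * lagrangeResolvent ω a = 3 * (a 0 ^ 2 - a 1 * a 2) := by
  simp only [lagrangeResolvent_eq]
  linear_combination (2 * a 0 * a 1 + 2 * a 0 * a 2 * (ω ^ 2 - ω + 1) + a 1 ^ 2 * ω +
    a 2 ^ 2 * ω ^ 2 * (ω ^ 2 - ω + 1) + a 1 * a 2 * (ω ^ 3 + ω ^ 2 - 2 * ω + 3)) * hω

lemma sub_mul_eq_zero_of_lagrangeResolvent_dvd {R : Type*} [CommRing R] {ω : R}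
    (hω : ω ^ 2 + ω + 1 = 0) {a : Fin 3 → R} (ha : ∑ i, a i ^ 3 = 3 * ∏ i, a i) {g : R}
    (hg : ∀ θ : R, θ ^ 3 = 1 → lagrangeResolvent θ a ∣ g) :
    3 * (a 0 ^ 3 - ∏ i, a i) * g = 0 := by
  have hω3 : ω ^ 3 = 1 := by linear_combination (ω - 1) * hω
  have hmul := lagrangeResolvent_mul_mul hω a
  have hadd := lagrangeResolvent_mul_add hω a
  obtain ⟨g₀, h₀⟩ := hg 1 (one_pow 3)
  obtain ⟨g₁, h₁⟩ := hg ω hω3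
  obtain ⟨g₂, h₂⟩ := hg (ω ^ 2) (by rw [pow_right_comm, hω3, one_pow])
  rw [ha, sub_self] at hmul
  rw [Fin.prod_univ_three]
  linear_combination -a 0 * g * hadd + a 0 * (g₀ + g₁ + g₂) * hmul +
    a 0 * lagrangeResolvent ω a * lagrangeResolvent (ω ^ 2) a * h₀ +
    a 0 * lagrangeResolvent 1 a * lagrangeResolvent (ω ^ 2) a * h₁ +
    a 0 * lagrangeResolvent 1 a * lagrangeResolvent ω a * h₂

lemma pow_sub_mul_eq_zero_of_pullback_eq_zero (hr : r ^ 2 = 2) {ω : K} (hω : IsPrimitiveRoot ω 3)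
    (h : m * n ∣ 24) (hm : 3 ∣ m) {S : Type*} [CommRing S] [Algebra K S] {φ : WeberRing r n →ₐ[K] S}
    {y : Fin 3 → S} (hy : ∀ i, y i ^ m = φ (coord r n i))
    (hprod : ∏ i, y i = algebraMap K S (weberConst r (m * n))) {f : WeberRing r n}
    (hf : pullback hr h f = 0) : 3 * (φ (coord r n 0) ^ n - 16) * φ f = 0 := by
  have hmn := hm.mul_right n
  have hprod' : ∏ i, y i = algebraMap K S (weberConst r (m * n)) * 1 ^ 3 := by
    rw [hprod, one_pow, mul_one]
  have hpow : IsWeberPoint r n (y ^ m) (1 ^ m) := by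
    simpa [funext hy, Pi.pow_def] using (isWeberPoint_coord r n).map φ
  have hdvd (θ : S) (hθ : θ ^ 3 = 1) :
      lagrangeResolvent θ (fun i => y i ^ coverExp (m * n)) ∣ φ f := by
    rw [← pow_mul_self_of_cube_eq_one
      (not_three_dvd_of_dvd_eight (coverExp_dvd_eight h)) hθ, pow_mul]
    exact lagrangeResolvent_dvd_of_pullback_eq_zero hr h hm hy hprod
      (by rw [pow_right_comm, hθ, one_pow]) hf
  have hω' : algebraMap K S ω ^ 2 + algebraMap K S ω + 1 = 0 := by
    have hgeom := hω.geom_sum_eq_zero (by norm_num)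
    simp only [Finset.sum_range_succ, Finset.sum_range_zero] at hgeom
    rw [← map_pow, ← map_add, ← map_one (algebraMap K S), ← map_add,
      show ω ^ 2 + ω + 1 = 0 by linear_combination hgeom, map_zero]
  have hzero := sub_mul_eq_zero_of_lagrangeResolvent_dvd hω'
    (sum_pow_coverExp_cube hr h hm hpow hprod') hdvd
  rwa [prod_pow_coverExp hr hmn h hprod', pow_coverExp_cube hmn, pow_mul, hy, one_pow,
    mul_one] at hzero

variable [CharZero K]

theorem pullback_injective (hr : r ^ 2 = 2) {ω : K} (hω : IsPrimitiveRoot ω 3)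
    (h : m * n ∣ 24) : Function.Injective (pullback hr h) := by
  have hm0 : m ≠ 0 := by rintro rfl; simp at h
  have hn0 : n ≠ 0 := by rintro rfl; simp at h
  obtain ⟨S, _, _, φ, y, hφ, hy, hprod⟩ := exists_injective_pow_eq_prod_eq hm0 (x := coord r n)
    (weberConst_ne_zero hr (m * n)) (by
      rw [weberConst_pow hr h, (isWeberPoint_coord r n).2, one_pow, mul_one])
  by_cases hm : 3 ∣ m
  · refine (injective_iff_map_eq_zero _).2 fun f hf => ?_
    have hp : Polynomial.C (3 : K) * (Polynomial.X ^ n - Polynomial.C 16) ≠ 0 :=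
      mul_ne_zero (Polynomial.C_ne_zero.2 three_ne_zero)
        (Polynomial.X_pow_sub_C_ne_zero (Nat.pos_of_ne_zero hn0) 16)
    refine eq_zero_of_aeval_coord_zero_mul_eq_zero hr ((Dvd.intro_left _ rfl).trans h) hp (hφ ?_)
    simpa [map_ofNat (algebraMap K S)] using
      pow_sub_mul_eq_zero_of_pullback_eq_zero hr hω h hm hy hprod hf
  · have hpow : IsWeberPoint r n (y ^ m) 1 := by
      simpa [funext hy, Pi.pow_def] using (isWeberPoint_coord r n).map φ
    have hpoint : IsWeberPoint r (m * n) y 1 := (isWeberPoint_iff_of_not_dvd hm h).2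
      ⟨by simpa using hpow.1, by rw [hprod, one_pow, mul_one]⟩
    have hcomp : (weberLift y hpoint).comp (pullback hr h) = φ :=
      weberRing_algHom_ext fun i => by simp [hy]
    refine Function.Injective.of_comp (f := weberLift y hpoint) ?_
    rwa [← AlgHom.coe_comp, hcomp]

theorem isDomain_weberRing (hr : r ^ 2 = 2) {ω : K} (hω : IsPrimitiveRoot ω 3) {N : ℕ}
    (hN : N ∣ 24) : IsDomain (WeberRing r N) := by
  obtain ⟨k, hk⟩ := hN
  rw [mul_comm] at hk
  have : IsDomain (WeberRing r (k * N)) := hk ▸ isDomain_weberRing_twentyFour hr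
  exact (pullback_injective hr hω hk.symm.dvd).isDomain (pullback hr hk.symm.dvd).toRingHom

end PullbackInjective

/-! ### Fibres and function fields -/

section Fibres

section CubeRoots

variable {F : Type*} [Field F] {a α : Fin 3 → F}

lemma forall_eq_or_sum_eq_zero (hα : ∀ i, α i ^ 3 = 1) (hprod : ∏ i, α i = 1) :
    (∀ i j, α i = α j) ∨ ∑ i, α i = 0 := by
  have hα0 (i : Fin 3) : α i ≠ 0 := fun h => by simpa [h] using hα i
  rw [Fin.prod_univ_three] at hprod
  by_cases h : α 0 = α 1
  · have h12 : α 2 = α 1 := by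
      refine mul_left_cancel₀ (mul_ne_zero (hα0 1) (hα0 1)) ?_
      rw [h] at hprod
      linear_combination hprod - hα 1
    have hall (i : Fin 3) : α i = α 1 := by fin_cases i; exacts [h, rfl, h12]
    exact Or.inl fun i j => (hall i).trans (hall j).symm
  · have hquad : α 0 ^ 2 + α 0 * α 1 + α 1 ^ 2 = 0 := by
      refine mul_left_cancel₀ (sub_ne_zero.2 h) ?_
      linear_combination hα 0 - hα 1
    refine Or.inr (mul_left_cancel₀ (mul_ne_zero (hα0 0) (hα0 1)) ?_)
    rw [Fin.sum_univ_three]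
    linear_combination hprod + α 1 * hquad - hα 1

variable [CharZero F]

/-- The kernel of the matrix with rows `(1, 1, 1)` and `α` is spanned by `α` when the entries of
`α` are the three cube roots of unity. -/
lemma forall_eq_or_forall_cube_eq (hα : ∀ i, α i ^ 3 = 1) (hprod : ∏ i, α i = 1)
    (ha : ∑ i, a i = 0) (hαa : ∑ i, α i * a i = 0) :
    (∀ i j, α i = α j) ∨ ∀ i j, a i ^ 3 = a j ^ 3 := by
  refine (forall_eq_or_sum_eq_zero hα hprod).imp_right fun hsum => ?_
  have hα1 : α 1 ≠ 0 := fun h => by simpa [h] using hα 1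
  rw [Fin.sum_univ_three] at ha hαa hsum
  rw [Fin.prod_univ_three] at hprod
  have hquad : α 0 ^ 2 + α 0 * α 1 + α 1 ^ 2 = 0 := by
    refine mul_left_cancel₀ hα1 ?_
    linear_combination -hprod + α 0 * α 1 * hsum + hα 1
  have hne : 2 * α 0 + α 1 ≠ 0 := fun h => by
    have h3 : 3 * α 1 ^ 2 = 0 := by linear_combination 4 * hquad - (2 * α 0 + α 1) * h
    exact hα1 (by simpa using h3)
  have h01 : a 0 * α 1 = a 1 * α 0 := by
    refine mul_left_cancel₀ hne ?_
    linear_combination α 1 * hαa - α 1 * α 2 * ha - 2 * a 1 * hquad + a 0 * α 1 * hsum +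
      a 1 * α 1 * hsum
  have h12 : a 1 * α 2 = a 2 * α 1 := by
    linear_combination h01 + a 1 * hsum - α 1 * ha
  have hcube {i j : Fin 3} (h : a i * α j = a j * α i) : a i ^ 3 = a j ^ 3 := by
    have h3 : (a i * α j) ^ 3 = (a j * α i) ^ 3 := by rw [h]
    simpa only [mul_pow, hα, mul_one] using h3
  have hall (i : Fin 3) : a i ^ 3 = a 1 ^ 3 := by
    fin_cases i
    exacts [hcube h01, rfl, (hcube h12).symm]
  exact fun i j => (hall i).trans (hall j).symm

end CubeRoots

variable {K F : Type*} [Field K] [CharZero K] [Field F] [Algebra K F] {r : K} {m n N : ℕ}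
  {x y : Fin 3 → F} {d : F}

lemma IsWeberPoint.ne_zero (hr : r ^ 2 = 2) (hx : IsWeberPoint r N x d) (hd : d ≠ 0) (i : Fin 3) :
    x i ≠ 0 := by
  refine Finset.prod_ne_zero_iff.1 ?_ i (Finset.mem_univ i)
  rw [hx.2]
  exact mul_ne_zero ((map_ne_zero _).2 (weberConst_ne_zero hr N)) (pow_ne_zero 3 hd)

lemma div_pow_coverExp_eq (hr : r ^ 2 = 2) (hN : 3 ∣ N) (hd : d ≠ 0)
    (hx : IsWeberPoint r N x d) (hy : IsWeberPoint r N y d) (hxy : x ^ N = y ^ N)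
    (hgen : ¬ ∀ i j, x i ^ N = x j ^ N) (i j : Fin 3) :
    (y i / x i) ^ coverExp N = (y j / x j) ^ coverExp N := by
  have := charZero_of_injective_algebraMap (algebraMap K F).injective
  have hx0 := hx.ne_zero hr hd
  have hdiv (i : Fin 3) : (y i / x i) ^ coverExp N * x i ^ coverExp N = y i ^ coverExp N := by
    rw [← mul_pow, div_mul_cancel₀ _ (hx0 i)]
  refine (forall_eq_or_forall_cube_eq (α := fun i => (y i / x i) ^ coverExp N)
    (a := fun i => x i ^ coverExp N) (fun i => ?_) ?_
    ((isWeberPoint_iff_of_dvd hN).1 hx).1 ?_).resolve_right ?_ i j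
  · rw [pow_coverExp_cube hN, div_pow, div_eq_one_iff_eq (pow_ne_zero _ (hx0 i))]
    exact (congrFun hxy i).symm
  · rw [Finset.prod_pow, Finset.prod_div_distrib, hx.2, hy.2, div_self, one_pow]
    rw [← hx.2]
    exact Finset.prod_ne_zero_iff.2 fun i _ => hx0 i
  · simp only [hdiv, ((isWeberPoint_iff_of_dvd hN).1 hy).1]
  · simpa only [pow_coverExp_cube hN] using hgen

theorem exists_mem_coverGroup_of_pow_eq (hr : r ^ 2 = 2) {ζ : K} (hζ : IsPrimitiveRoot ζ m)
    (h : m * n ∣ 24) (hd : d ≠ 0) (hx : IsWeberPoint r (m * n) x d)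
    (hy : IsWeberPoint r (m * n) y d) (hxy : x ^ m = y ^ m)
    (hgen : 3 ∣ m → ¬ ∀ i j, x i ^ (m * n) = x j ^ (m * n)) :
    ∃ g ∈ coverGroup m K, ∀ i, y i = algebraMap K F (rootVal (g i)) * x i := by
  have : NeZero m := ⟨by rintro rfl; simp at h⟩
  have hx0 := hx.ne_zero hr hd
  have hy0 := hy.ne_zero hr hd
  have hm (i : Fin 3) : (y i / x i) ^ m = 1 := by
    rw [div_pow, div_eq_one_iff_eq (pow_ne_zero _ (hx0 i))]
    exact (congrFun hxy i).symm
  have hpow (i j : Fin 3) : (y i / x i) ^ coverExp m = (y j / x j) ^ coverExp m := by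
    have hj : y j / x j ≠ 0 := div_ne_zero (hy0 j) (hx0 j)
    rw [← div_eq_one_iff_eq (pow_ne_zero _ hj), ← div_pow]
    refine pow_coverExp_eq_one h (by rw [div_pow, hm, hm, div_one]) ?_
    rw [div_pow, div_eq_one_iff_eq (pow_ne_zero _ hj)]
    by_cases h3 : 3 ∣ m
    · refine div_pow_coverExp_eq hr (h3.mul_right n) hd hx hy ?_ (hgen h3) i j
      rw [pow_mul, hxy, pow_mul]
    · rw [coverExp_mul h, coverExp_of_not_dvd h3, pow_mul, pow_mul, hm, hm]
  obtain ⟨g, hg, hgx⟩ := exists_mem_coverGroup_algebraMap_eq hζ hm (by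
    rw [Finset.prod_div_distrib, hx.2, hy.2, ← hx.2,
      div_self (Finset.prod_ne_zero_iff.2 fun i _ => hx0 i)]) hpow
  exact ⟨g, hg, fun i => by rw [hgx, div_mul_cancel₀ _ (hx0 i)]⟩

end Fibres

section Kummer

variable {F L : Type*} [Field F] [Field L] [Algebra F L] {m : ℕ}

lemma isIntegral_of_pow_mem (hm : m ≠ 0) {y : L} (hy : y ^ m ∈ (algebraMap F L).range) :
    IsIntegral F y := by
  obtain ⟨a, ha⟩ := hy
  exact IsIntegral.of_pow (Nat.pos_of_ne_zero hm) (ha ▸ isIntegral_algebraMap)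

lemma splits_minpoly_of_pow_mem {ζ : L} (hζ : IsPrimitiveRoot ζ m) (hm : m ≠ 0) {y : L}
    (hy : y ^ m ∈ (algebraMap F L).range) : ((minpoly F y).map (algebraMap F L)).Splits := by
  obtain ⟨a, ha⟩ := hy
  refine (X_pow_sub_C_splits_of_isPrimitiveRoot hζ ha.symm).of_dvd
    (Polynomial.X_pow_sub_C_ne_zero (Nat.pos_of_ne_zero hm) _) ?_
  have hdvd : minpoly F y ∣ Polynomial.X ^ m - Polynomial.C a := minpoly.dvd F y (by simp [ha])
  simpa using Polynomial.map_dvd (algebraMap F L) hdvd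

lemma isGalois_of_pow_mem [PerfectField F] {S : Set L} {ζ : L} (hζ : IsPrimitiveRoot ζ m)
    (hm : m ≠ 0) (hS : ∀ y ∈ S, y ^ m ∈ (algebraMap F L).range)
    (htop : IntermediateField.adjoin F S = ⊤) : IsGalois F L := by
  have hle : IntermediateField.adjoin F S ≤ algebraicClosure F L :=
    IntermediateField.adjoin_le_iff.2 fun y hy =>
      mem_algebraicClosure_iff.2 (isIntegral_of_pow_mem hm (hS y hy)).isAlgebraic
  have : Algebra.IsAlgebraic F L := (algebraicClosure.eq_top_iff F L).1 (top_le_iff.1 (htop ▸ hle))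
  refine isGalois_iff.2 ⟨inferInstance, normal_iff.2 fun y => ⟨Algebra.IsIntegral.isIntegral y, ?_⟩⟩
  exact IntermediateField.splits_of_mem_adjoin F L
    (fun y hy => ⟨isIntegral_of_pow_mem hm (hS y hy), splits_minpoly_of_pow_mem hζ hm (hS y hy)⟩)
    (htop ▸ trivial)

end Kummer

section CoordFun

variable {K : Type*} [Field K] {r : K} {N : ℕ}

lemma adjoin_coord (r : K) (N : ℕ) : Algebra.adjoin K (Set.range (coord r N)) = ⊤ := by
  have hrange : Set.range (coord r N) = Ideal.Quotient.mkₐ K (weberIdeal r N) '' Set.range X := by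
    rw [← Set.range_comp]
    rfl
  rw [hrange, ← AlgHom.map_adjoin, adjoin_range_X, Algebra.map_top, AlgHom.range_eq_top]
  exact Ideal.Quotient.mkₐ_surjective K _

lemma not_forall_coord_pow_eq [CharZero K] (hr : r ^ 2 = 2) (hN : N ∣ 24)
    [Nontrivial (WeberRing r N)] : ¬ ∀ i j, coord r N i ^ N = coord r N j ^ N := fun h => by
  have hN0 : N ≠ 0 := ne_zero_of_dvd_ne_zero (by norm_num) hN
  refine one_ne_zero (eq_zero_of_aeval_coord_zero_mul_eq_zero (f := (1 : WeberRing r N)) hr hN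
    (Polynomial.X_pow_sub_C_ne_zero (by positivity : 0 < N * 3) (weberConst r N ^ N)) ?_)
  have hprod : ∏ i, coord r N i ^ N = (coord r N 0 ^ N) ^ 3 := by
    simp only [h _ 0, Finset.prod_const, Finset.card_univ, Fintype.card_fin]
  rw [Finset.prod_pow, (isWeberPoint_coord r N).2, one_pow, mul_one, ← pow_mul, ← map_pow] at hprod
  rw [map_sub, map_pow, Polynomial.aeval_X, Polynomial.aeval_C, ← hprod, sub_self, zero_mul]

lemma isWeberPoint_coordFun (r : K) (N : ℕ) : IsWeberPoint r N (coordFun r N) 1 := by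
  have hmap := (isWeberPoint_coord r N).map (IsScalarTower.toAlgHom K _ (WeberField r N))
  rwa [map_one] at hmap

lemma coordFun_ne_zero [CharZero K] (hr : r ^ 2 = 2) [IsDomain (WeberRing r N)] (i : Fin 3) :
    coordFun r N i ≠ 0 :=
  (isWeberPoint_coordFun r N).ne_zero hr one_ne_zero i

lemma weberField_algHom_ext {A : Type*} [CommRing A] [Algebra K A] {f g : WeberField r N →ₐ[K] A}
    (h : ∀ i, f (coordFun r N i) = g (coordFun r N i)) : f = g :=
  IsLocalization.algHom_ext (nonZeroDivisors (WeberRing r N)) (weberRing_algHom_ext h)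

end CoordFun

section CoordinateScaling

variable {K : Type*} [Field K] {r : K} {m n : ℕ}

/-- The action of the Galois group on the coordinate ring of `W_{mn}`, by scaling the coordinate
functions. -/
noncomputable def scaleHom (r : K) (h : m * n ∣ 24) :
    coverGroup m K →* (WeberRing r (m * n) →ₐ[K] WeberRing r (m * n)) where
  toFun g := weberLift _ ((isWeberPoint_coord r (m * n)).rootVal_mul h g.2)
  map_one' := weberRing_algHom_ext fun i => by simp
  map_mul' g g' := weberRing_algHom_ext fun i => by simp [mul_left_comm, mul_assoc]

lemma scaleHom_coord (h : m * n ∣ 24) (g : coverGroup m K) (i : Fin 3) :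
    scaleHom r h g (coord r (m * n) i) =
      algebraMap K _ (rootVal (g.1 i)) * coord r (m * n) i :=
  weberLift_coord _ ((isWeberPoint_coord r (m * n)).rootVal_mul h g.2) i

lemma scaleHom_pullback (hr : r ^ 2 = 2) (h : m * n ∣ 24) (g : coverGroup m K)
    (f : WeberRing r n) : scaleHom r h g (pullback hr h f) = pullback hr h f := by
  have : (scaleHom r h g).comp (pullback hr h) = pullback hr h := by
    refine weberRing_algHom_ext fun i => ?_
    rw [AlgHom.comp_apply, pullback_coord, map_pow, scaleHom_coord, mul_pow, ← map_pow,
      rootVal_pow_eq_one, map_one, one_mul]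
  exact DFunLike.congr_fun this f

/-- The action of the Galois group on the function field of `W_{mn}` induced by `scaleHom`. -/
noncomputable def scaleFieldHom (r : K) (h : m * n ∣ 24) [IsDomain (WeberRing r (m * n))] :
    coverGroup m K →* (WeberField r (m * n) ≃ₐ[K] WeberField r (m * n)) :=
  (IsFractionRing.fieldEquivOfAlgEquivHom K (WeberField r (m * n))).comp
    ((AlgEquiv.algHomUnitsEquiv K _).toMonoidHom.comp (scaleHom r h).toHomUnits)

lemma scaleFieldHom_algebraMap (h : m * n ∣ 24) [IsDomain (WeberRing r (m * n))]
    (g : coverGroup m K) (f : WeberRing r (m * n)) :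
    scaleFieldHom r h g (algebraMap _ _ f) = algebraMap _ _ (scaleHom r h g f) :=
  IsFractionRing.fieldEquivOfAlgEquiv_algebraMap K _ _ _ f

end CoordinateScaling

section FunctionField

variable {K : Type*} [Field K] {r : K} (hr : r ^ 2 = 2) {m n : ℕ} (h : m * n ∣ 24)
  [IsDomain (WeberRing r n)] [IsDomain (WeberRing r (m * n))]
  (hinj : Function.Injective (pullback hr h).toRingHom)

lemma algebraMap_pullback_mem (f : WeberRing r n) :
    algebraMap (WeberRing r (m * n)) (WeberField r (m * n)) (pullback hr h f) ∈
      pullbackField hr h hinj :=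
  ⟨algebraMap (WeberRing r n) (WeberField r n) f, IsLocalization.map_eq _ f⟩

lemma algebraMap_mem_pullbackField (a : K) :
    algebraMap K (WeberField r (m * n)) a ∈ pullbackField hr h hinj := by
  have := algebraMap_pullback_mem hr h hinj (algebraMap K _ a)
  rwa [AlgHom.commutes] at this

noncomputable instance : Algebra K (pullbackField hr h hinj) :=
  ((algebraMap K (WeberField r (m * n))).codRestrict _
    (algebraMap_mem_pullbackField hr h hinj)).toAlgebra

instance : IsScalarTower K (pullbackField hr h hinj) (WeberField r (m * n)) :=
  .of_algebraMap_eq fun _ => rfl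

lemma coordFun_pow_mem (i : Fin 3) :
    coordFun r (m * n) i ^ m ∈ pullbackField hr h hinj := by
  have := algebraMap_pullback_mem hr h hinj (coord r n i)
  rwa [pullback_coord, map_pow] at this

lemma adjoin_coordFun_eq_top :
    IntermediateField.adjoin (pullbackField hr h hinj) (Set.range (coordFun r (m * n))) = ⊤ := by
  set E := IntermediateField.adjoin (pullbackField hr h hinj) (Set.range (coordFun r (m * n)))
  have hle : Algebra.adjoin K (Set.range (coord r (m * n))) ≤
      (E.restrictScalars K).toSubalgebra.comap (IsScalarTower.toAlgHom K _ _) := by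
    refine Algebra.adjoin_le ?_
    rintro _ ⟨i, rfl⟩
    exact IntermediateField.subset_adjoin _ _ ⟨i, rfl⟩
  rw [adjoin_coord] at hle
  refine eq_top_iff.2 fun f _ => ?_
  obtain ⟨a, b, -, rfl⟩ := IsFractionRing.div_surjective (WeberRing r (m * n)) f
  exact E.div_mem (hle (Algebra.mem_top (x := a))) (hle (Algebra.mem_top (x := b)))

lemma scaleFieldHom_eq_self (g : coverGroup m K) (f : pullbackField hr h hinj) :
    scaleFieldHom r h g f = f := by
  obtain ⟨_, f, rfl⟩ := f
  have key (a : WeberRing r n) :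
      IsFractionRing.map (K := WeberField r n) (L := WeberField r (m * n)) hinj
        (algebraMap _ _ a) = algebraMap _ _ (pullback hr h a) := IsLocalization.map_eq _ a
  obtain ⟨a, b, -, rfl⟩ := IsFractionRing.div_surjective (WeberRing r n) f
  simp only [map_div₀, key, scaleFieldHom_algebraMap, scaleHom_pullback]

/-- The action of the Galois group on the function field of `W_{mn}`, as automorphisms over that of
`W_n`. -/
noncomputable def galoisHom : coverGroup m K →*
    (WeberField r (m * n) ≃ₐ[pullbackField hr h hinj] WeberField r (m * n)) where
  toFun g := { scaleFieldHom r h g with commutes' := scaleFieldHom_eq_self hr h hinj g }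
  map_one' := AlgEquiv.ext fun f => DFunLike.congr_fun (map_one (scaleFieldHom r h)) f
  map_mul' g g' := AlgEquiv.ext fun f => DFunLike.congr_fun (map_mul (scaleFieldHom r h) g g') f

lemma galoisHom_coordFun (g : coverGroup m K) (i : Fin 3) :
    galoisHom hr h hinj g (coordFun r (m * n) i) = rootVal (g.1 i) • coordFun r (m * n) i := by
  refine (scaleFieldHom_algebraMap h g _).trans ?_
  rw [scaleHom_coord, map_mul, ← IsScalarTower.algebraMap_apply, ← Algebra.smul_def]
  rfl

variable [CharZero K]

lemma galoisHom_injective : Function.Injective (galoisHom hr h hinj) := by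
  intro g g' hg
  refine Subtype.ext (funext fun i => rootVal_injective ?_)
  refine smul_left_injective K (coordFun_ne_zero (N := m * n) hr i) ?_
  have := DFunLike.congr_fun hg (coordFun r (m * n) i)
  rwa [galoisHom_coordFun, galoisHom_coordFun] at this

lemma galoisHom_surjective {ζ : K} (hζ : IsPrimitiveRoot ζ m) :
    Function.Surjective (galoisHom hr h hinj) := by
  intro σ
  have hx := isWeberPoint_coordFun r (m * n)
  have hy := hx.map (σ.toAlgHom.restrictScalars K)
  rw [map_one] at hy
  have hxy : coordFun r (m * n) ^ m = (fun i => σ (coordFun r (m * n) i)) ^ m := funext fun i =>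
    (σ.commutes ⟨_, coordFun_pow_mem hr h hinj i⟩).symm.trans (map_pow σ _ m)
  have hgen : ¬ ∀ i j, coordFun r (m * n) i ^ (m * n) = coordFun r (m * n) j ^ (m * n) := by
    refine fun hall => not_forall_coord_pow_eq hr h fun i j => ?_
    refine IsFractionRing.injective (WeberRing r (m * n)) (WeberField r (m * n)) ?_
    rw [map_pow, map_pow]
    exact hall i j
  obtain ⟨g, hg, hσ⟩ :=
    exists_mem_coverGroup_of_pow_eq hr hζ h one_ne_zero hx hy hxy fun _ => hgen
  refine ⟨⟨g, hg⟩, AlgEquiv.ext fun f => ?_⟩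
  have heq : (galoisHom hr h hinj ⟨g, hg⟩).toAlgHom.restrictScalars K =
      σ.toAlgHom.restrictScalars K :=
    weberField_algHom_ext fun i =>
      (galoisHom_coordFun hr h hinj _ i).trans ((Algebra.smul_def _ _).trans (hσ i).symm)
  exact DFunLike.congr_fun heq f

theorem isGalois_pullbackField {ζ : K} (hζ : IsPrimitiveRoot ζ m) :
    IsGalois (pullbackField hr h hinj) (WeberField r (m * n)) := by
  have hm : m ≠ 0 := by rintro rfl; simp at h
  have : CharZero (pullbackField hr h hinj) := charZero_of_injective_algebraMap
    (algebraMap K (pullbackField hr h hinj)).injective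
  exact isGalois_of_pow_mem
    (hζ.map_of_injective (algebraMap K (WeberField r (m * n))).injective) hm
    (Set.forall_mem_range.2 fun i => ⟨⟨_, coordFun_pow_mem hr h hinj i⟩, rfl⟩)
    (adjoin_coordFun_eq_top hr h hinj)

/-- The identification of `coverGroup m K` with the Galois group of the function field of `W_{mn}`
over that of `W_n`. -/
noncomputable def galoisEquiv {ζ : K} (hζ : IsPrimitiveRoot ζ m) :
    coverGroup m K ≃* (WeberField r (m * n) ≃ₐ[pullbackField hr h hinj] WeberField r (m * n)) :=
  MulEquiv.ofBijective (galoisHom hr h hinj)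
    ⟨galoisHom_injective hr h hinj, galoisHom_surjective hr h hinj hζ⟩

lemma finiteDimensional_pullbackField {ζ : K} (hζ : IsPrimitiveRoot ζ m) :
    FiniteDimensional (pullbackField hr h hinj) (WeberField r (m * n)) := by
  have : NeZero m := ⟨by rintro rfl; simp at h⟩
  have := isGalois_pullbackField hr h hinj hζ
  have : Finite (WeberField r (m * n) ≃ₐ[pullbackField hr h hinj] WeberField r (m * n)) :=
    .of_equiv _ (galoisEquiv hr h hinj hζ).toEquiv
  exact IsGalois.finiteDimensional_of_finite _ _

theorem mem_pullbackField_iff {ζ : K} (hζ : IsPrimitiveRoot ζ m) (f : WeberField r (m * n)) :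
    f ∈ pullbackField hr h hinj ↔ ∀ g, galoisEquiv hr h hinj hζ g f = f := by
  have := isGalois_pullbackField hr h hinj hζ
  have := finiteDimensional_pullbackField hr h hinj hζ
  rw [← (galoisEquiv hr h hinj hζ).surjective.forall (p := fun σ => σ f = f),
    ← IsGalois.mem_range_algebraMap_iff_fixed]
  exact Subtype.range_coe.symm ▸ Iff.rfl

theorem finrank_pullbackField {ζ : K} (hζ : IsPrimitiveRoot ζ m) :
    Module.finrank (pullbackField hr h hinj) (WeberField r (m * n)) =
      Nat.card (coverGroup m K) := by
  have := isGalois_pullbackField hr h hinj hζ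
  have := finiteDimensional_pullbackField hr h hinj hζ
  rw [Nat.card_congr (galoisEquiv hr h hinj hζ).toEquiv, IsGalois.card_aut_eq_finrank]

end FunctionField

section Card

variable (m : ℕ) (K : Type*) [Field K]

lemma card_diagonalGroup : Nat.card (diagonalGroup m K) = Nat.card (rootsOfUnity m K) := by
  refine (Nat.card_congr
    (.ofBijective (fun a => ⟨fun _ => a, a, rfl⟩) ⟨fun a b hab => ?_, ?_⟩)).symm
  · exact congrFun (congrArg Subtype.val hab) 0
  · rintro ⟨_, a, rfl⟩
    exact ⟨a, rfl⟩

lemma card_antidiagonalGroup :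
    Nat.card (antidiagonalGroup m K) = Nat.card (rootsOfUnity m K) ^ 2 := by
  rw [sq, ← Nat.card_prod]
  refine (Nat.card_congr (.ofBijective (fun p => ⟨![p.1, p.2, (p.1 * p.2)⁻¹], p.1, p.2, rfl⟩)
    ⟨fun p q hpq => ?_, ?_⟩)).symm
  · have := congrArg Subtype.val hpq
    exact Prod.ext (congrFun this 0) (congrFun this 1)
  · rintro ⟨_, a, b, rfl⟩
    exact ⟨(a, b), rfl⟩

end Card

section CardCoverGroup

variable {m : ℕ} {K : Type*} [Field K] {ζ : K}

lemma card_coverGroup_three (hζ : IsPrimitiveRoot ζ 3) : Nat.card (coverGroup 3 K) = 3 := by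
  rw [coverGroup_three, card_diagonalGroup, hζ.card_rootsOfUnity]

lemma card_coverGroup_of_dvd_eight (hζ : IsPrimitiveRoot ζ m) (hm : m ∣ 8) :
    Nat.card (coverGroup m K) = m ^ 2 := by
  have : NeZero m := ⟨ne_zero_of_dvd_ne_zero (by norm_num) hm⟩
  rw [coverGroup_of_dvd_eight hm, card_antidiagonalGroup, hζ.card_rootsOfUnity]

end CardCoverGroup

/-! ### The projective curves -/

section ProjectivePoints

variable {K : Type*} [Field K] {r : K} {m n N : ℕ} {v w : Fin 4 → K}

lemma eval_weberForms_iff (v : Fin 4 → K) :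
    (eval v (weberForm₁ K N) = 0 ∧ eval v (weberForm₂ r N) = 0) ↔
      IsWeberPoint r N (v ∘ Fin.castSucc) (v 3) := by
  unfold IsWeberPoint weberForm₁ weberForm₂ coverExp weberCoeff
  split_ifs <;> simp [sub_eq_zero, Fin.sum_univ_three, Fin.prod_univ_three]

lemma mk_mem_weberCurve (hv : v ≠ 0) :
    Projectivization.mk K v hv ∈ weberCurve r N ↔
      IsWeberPoint r N (v ∘ Fin.castSucc) (v 3) := by
  refine (eval_weberForms_iff _).trans ?_
  obtain ⟨a, ha⟩ := Projectivization.exists_smul_eq_mk_rep K v hv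
  rw [← ha]
  refine ⟨fun h => ?_, fun h => h.smul (a : K)⟩
  rw [← inv_smul_smul a v]
  exact h.smul ((a⁻¹ : Kˣ) : K)

lemma powMap_mk (m : ℕ) (hv : v ≠ 0) (hvm : v ^ m ≠ 0) :
    powMap m (Projectivization.mk K v hv) = Projectivization.mk K (v ^ m) hvm := rfl

lemma exists_rootAct_mk (g : Fin 3 → rootsOfUnity m K) (hv : v ≠ 0) :
    ∃ w hw, rootAct g (Projectivization.mk K v hv) = Projectivization.mk K w hw ∧
      (∀ i : Fin 3, w i.castSucc = rootVal (g i) * v i.castSucc) ∧ w 3 = v 3 := by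
  refine ⟨_, _, Projectivization.map_mk _ _ v hv, fun i => ?_, one_smul Kˣ (v 3)⟩
  fin_cases i <;> rfl

lemma rootAct_mk_eq_mk {g : Fin 3 → rootsOfUnity m K} (hv : v ≠ 0) (hw : w ≠ 0) {a : K}
    (hvw : ∀ i : Fin 3, a * w i.castSucc = rootVal (g i) * v i.castSucc)
    (hvw₃ : a * w 3 = v 3) :
    rootAct g (Projectivization.mk K v hv) = Projectivization.mk K w hw := by
  obtain ⟨u, hu, hvu, hui, hu3⟩ := exists_rootAct_mk g hv
  rw [hvu, Projectivization.mk_eq_mk_iff']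
  refine ⟨a, funext fun j => ?_⟩
  induction j using Fin.lastCases with
  | last => exact hvw₃.trans hu3.symm
  | cast i => exact (hvw i).trans (hui i).symm

theorem mapsTo_powMap (hr : r ^ 2 = 2) (h : m * n ∣ 24) :
    Set.MapsTo (powMap (K := K) m) (weberCurve r (m * n)) (weberCurve r n) := by
  intro P hP
  induction P using Projectivization.ind with
  | h v hv =>
    have hvm : v ^ m ≠ 0 := pow_ne_zero m hv
    rw [powMap_mk m hv hvm, mk_mem_weberCurve]
    exact ((mk_mem_weberCurve hv).1 hP).pow hr h

theorem surjOn_powMap [IsAlgClosed K] (hr : r ^ 2 = 2) (h : m * n ∣ 24) :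
    Set.SurjOn (powMap (K := K) m) (weberCurve r (m * n)) (weberCurve r n) := by
  have hm : m ≠ 0 := by rintro rfl; simp at h
  intro Q hQ
  induction Q using Projectivization.ind with
  | h w hw =>
    obtain ⟨y, δ, hyδ, hy, hδ⟩ := exists_isWeberPoint_pow_eq hr h ((mk_mem_weberCurve hw).1 hQ)
    obtain ⟨v, rfl, rfl⟩ : ∃ v : Fin 4 → K, v ∘ Fin.castSucc = y ∧ v 3 = δ :=
      ⟨Fin.snoc y δ, Fin.snoc_comp_castSucc, Fin.snoc_last _ _⟩
    obtain rfl : v ^ m = w := funext fun j => by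
      induction j using Fin.lastCases with
      | last => exact hδ
      | cast i => exact congrFun hy i
    have hv : v ≠ 0 := by rintro rfl; exact hw (zero_pow hm)
    exact ⟨Projectivization.mk K v hv, (mk_mem_weberCurve hv).2 hyδ, powMap_mk m hv hw⟩

theorem rootAct_mem_and_powMap_rootAct (h : m * n ∣ 24) {g : Fin 3 → rootsOfUnity m K}
    (hg : g ∈ coverGroup m K) {P : ℙ K (Fin 4 → K)} (hP : P ∈ weberCurve r (m * n)) :
    rootAct g P ∈ weberCurve r (m * n) ∧ powMap m (rootAct g P) = powMap m P := by
  induction P using Projectivization.ind with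
  | h v hv =>
    obtain ⟨w, hw, hvw, hwi, hw3⟩ := exists_rootAct_mk g hv
    have hpow : w ^ m = v ^ m := funext fun j => by
      induction j using Fin.lastCases with
      | last => exact congrArg (· ^ m) hw3
      | cast i => rw [Pi.pow_apply, hwi, mul_pow, rootVal_pow_eq_one, one_mul, Pi.pow_apply]
    constructor
    · have hwv : w ∘ Fin.castSucc = fun i => rootVal (g i) * v i.castSucc := funext hwi
      rw [hvw, mk_mem_weberCurve, hwv, hw3]
      exact ((mk_mem_weberCurve hv).1 hP).rootVal_mul h hg
    · rw [hvw, powMap_mk m hw (pow_ne_zero m hw), powMap_mk m hv (pow_ne_zero m hv)]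
      simp only [hpow]

end ProjectivePoints

section Nonsingular

variable {K : Type*} [Field K] {r : K} {n : ℕ}

lemma eval_pderiv_weberForm₁ (hn : ¬ 3 ∣ n) (w : Fin 4 → K) :
    (fun j => eval w (pderiv j (weberForm₁ K n))) =
      ![n * w 0 ^ (n - 1), n * w 1 ^ (n - 1), n * w 2 ^ (n - 1), -(48 * (n * w 3 ^ (n - 1)))] := by
  funext j
  fin_cases j <;>
    simp [weberForm₁, if_neg hn, Derivation.leibniz, Derivation.leibniz_pow, pderiv_X]

lemma eval_pderiv_weberForm₂ (n : ℕ) (w : Fin 4 → K) :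
    (fun j => eval w (pderiv j (weberForm₂ r n))) =
      ![w 1 * w 2, w 0 * w 2, w 0 * w 1, -(weberConst r n * (3 * w 3 ^ 2))] := by
  funext j
  fin_cases j <;>
    simp [weberForm₂, Derivation.leibniz, Derivation.leibniz_pow, pderiv_X, mul_comm]

variable [CharZero K] {v w : Fin 4 → K}

lemma pow_eq_sixteen_mul_pow (hn : ¬ 3 ∣ n) {x : Fin 3 → K} {d : K} (hx : IsWeberPoint r n x d)
    (hpow : ∀ i j, x i ^ n = x j ^ n) (i : Fin 3) : x i ^ n = 16 * d ^ n := by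
  have hsum := hx.1
  simp only [coverExp_of_not_dvd hn, weberCoeff, if_neg hn, fun j => hpow j i, Finset.sum_const,
    Finset.card_univ, Fintype.card_fin, nsmul_eq_mul] at hsum
  refine mul_left_cancel₀ (three_ne_zero (α := K)) ?_
  push_cast at hsum
  linear_combination hsum

/-- Where all `wᵢⁿ` with `i ≤ 2` agree, they equal `16 w₃ⁿ`, so that the gradients are
proportional to `(1/w₀, 1/w₁, 1/w₂, -3/w₃)`. -/
lemma not_linearIndependent_gradients (hr : r ^ 2 = 2) (hn0 : n ≠ 0) (hn : ¬ 3 ∣ n)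
    (hw : IsWeberPoint r n (w ∘ Fin.castSucc) (w 3)) (hw3 : w 3 ≠ 0)
    (hpow : ∀ i j : Fin 3, w i.castSucc ^ n = w j.castSucc ^ n) :
    ¬ LinearIndependent K ![fun j => eval w (pderiv j (weberForm₁ K n)),
      fun j => eval w (pderiv j (weberForm₂ r n))] := by
  have hS0 : w 0 ^ n = 16 * w 3 ^ n := pow_eq_sixteen_mul_pow hn hw hpow 0
  have hS1 : w 1 ^ n = 16 * w 3 ^ n := pow_eq_sixteen_mul_pow hn hw hpow 1
  have hS2 : w 2 ^ n = 16 * w 3 ^ n := pow_eq_sixteen_mul_pow hn hw hpow 2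
  have hw0 (j : Fin 4) : w j ≠ 0 := by
    induction j using Fin.lastCases with
    | last => exact hw3
    | cast i => exact hw.ne_zero hr hw3 i
  have hprod : w 0 * w 1 * w 2 = weberConst r n * w 3 ^ 3 := by
    simpa [Fin.prod_univ_three] using hw.2
  have hpred (j : Fin 4) : w j ^ (n - 1) * w j = w j ^ n := pow_sub_one_mul hn0 _
  rw [eval_pderiv_weberForm₁ hn, eval_pderiv_weberForm₂, LinearIndependent.pair_iff]
  intro hli
  refine mul_ne_zero (mul_ne_zero (hw0 0) (hw0 1)) (hw0 2)
    (hli (w 0 * w 1 * w 2) (-(n * (16 * w 3 ^ n))) (funext fun j => ?_)).1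
  refine mul_right_cancel₀ (hw0 j) ?_
  simp only [Pi.add_apply, Pi.smul_apply, smul_eq_mul, Pi.zero_apply, zero_mul]
  fin_cases j <;> simp only [Fin.zero_eta, Fin.mk_one, Fin.reduceFinMk, Matrix.cons_val]
  · linear_combination (w 0 * w 1 * w 2 * n) * (hpred 0 + hS0)
  · linear_combination (w 0 * w 1 * w 2 * n) * (hpred 1 + hS1)
  · linear_combination (w 0 * w 1 * w 2 * n) * (hpred 2 + hS2)
  · linear_combination (-48 * w 0 * w 1 * w 2 * n) * hpred 3 - 48 * n * w 3 ^ n * hprod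

lemma not_isNonsingularAt_mk (hr : r ^ 2 = 2) (hn0 : n ≠ 0) (hn : ¬ 3 ∣ n) (hv : v ≠ 0)
    (hvn : IsWeberPoint r n (v ∘ Fin.castSucc) (v 3)) (hv3 : v 3 ≠ 0)
    (hpow : ∀ i j : Fin 3, v i.castSucc ^ n = v j.castSucc ^ n) :
    ¬ IsNonsingularAt r n (Projectivization.mk K v hv) := by
  obtain ⟨a, ha⟩ := Projectivization.exists_smul_eq_mk_rep K v hv
  rw [IsNonsingularAt, ← ha]
  refine not_linearIndependent_gradients hr hn0 hn (hvn.smul (a : K))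
    (mul_ne_zero a.ne_zero hv3) fun i j => ?_
  simp only [Units.smul_def, Pi.smul_apply, smul_eq_mul, mul_pow, hpow i j]

end Nonsingular

section ProjectiveFibres

variable {K : Type*} [Field K] {r : K} {m n N : ℕ} {x y : Fin 3 → K} {t : K}

lemma exists_mem_coverGroup_rootVal_eq [NeZero m] {ζ ρ : K} (hζ : IsPrimitiveRoot ζ m)
    (hρm : ρ ^ m = 1) (hρ : ρ ^ coverExp m = 1) :
    ∃ g ∈ coverGroup m K, ∀ i, rootVal (g i) = (![ρ⁻¹, 1, ρ] : Fin 3 → K) i := by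
  have hρ0 : ρ ≠ 0 := by rintro rfl; simp [NeZero.ne m] at hρm
  have hpow {k : ℕ} (hk : ρ ^ k = 1) (i : Fin 3) : (![ρ⁻¹, 1, ρ] : Fin 3 → K) i ^ k = 1 := by
    fin_cases i <;> simp [hk]
  exact exists_mem_coverGroup_algebraMap_eq hζ (hpow hρm)
    (by simp [Fin.prod_univ_three, hρ0]) fun i j => (hpow hρ i).trans (hpow hρ j).symm

lemma IsWeberPoint.pow_add_pow_eq_zero (hN : N ∣ 24) (hx : IsWeberPoint r N x 0) (hx0 : x 0 = 0) :
    x 1 ^ coverExp N + x 2 ^ coverExp N = 0 := by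
  simpa [Fin.sum_univ_three, hx0, coverExp_ne_zero hN] using hx.1

lemma IsWeberPoint.ne_zero_and_ne_zero (hN : N ∣ 24) (hx : IsWeberPoint r N x 0) (hx0 : x 0 = 0)
    (hne : x ≠ 0) : x 1 ≠ 0 ∧ x 2 ≠ 0 := by
  have he := coverExp_ne_zero hN
  have hsum := hx.pow_add_pow_eq_zero hN hx0
  have h21 (h2 : x 2 = 0) : x 1 = 0 := by simpa [h2, he] using hsum
  have h1 : x 1 ≠ 0 := fun h1 => hne (funext fun i => by
    have h2 : x 2 = 0 := by simpa [h1, he] using hsum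
    fin_cases i
    exacts [hx0, h1, h2])
  exact ⟨h1, fun h2 => h1 (h21 h2)⟩

lemma exists_mul_eq_rootVal_mul_of_apply_zero_eq_zero {ζ : K} (hζ : IsPrimitiveRoot ζ m)
    (h : m * n ∣ 24) (hx : IsWeberPoint r (m * n) x 0) (hy : IsWeberPoint r (m * n) y 0)
    (hxy : t • y ^ m = x ^ m) (hx0 : x ≠ 0) (hx00 : x 0 = 0) (hy00 : y 0 = 0) :
    ∃ g ∈ coverGroup m K, ∃ a : K, ∀ i, a * y i = rootVal (g i) * x i := by
  have : NeZero m := ⟨by rintro rfl; simp at h⟩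
  have hxy' (i : Fin 3) : t * y i ^ m = x i ^ m := congrFun hxy i
  obtain ⟨hx1, hx2⟩ := hx.ne_zero_and_ne_zero h hx00 hx0
  have hy1 : y 1 ≠ 0 := fun hy1 => hx1 (by simpa [hy1, NeZero.ne m] using (hxy' 1).symm)
  have hpow {k : ℕ} (hk : (x 1 * y 2) ^ k = (y 1 * x 2) ^ k) :
      (x 1 * y 2 / (y 1 * x 2)) ^ k = 1 := by
    rw [div_pow, hk, div_self (pow_ne_zero k (mul_ne_zero hy1 hx2))]
  have hm := hpow (k := m) (by rw [mul_pow, mul_pow, ← hxy' 1, ← hxy' 2]; ring)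
  have he := hpow (k := coverExp (m * n)) (by
    rw [mul_pow, mul_pow]
    linear_combination x 1 ^ coverExp (m * n) * hy.pow_add_pow_eq_zero h hy00 -
      y 1 ^ coverExp (m * n) * hx.pow_add_pow_eq_zero h hx00)
  obtain ⟨g, hg, hgρ⟩ := exists_mem_coverGroup_rootVal_eq hζ hm (pow_coverExp_eq_one h hm he)
  refine ⟨g, hg, x 1 / y 1, fun i => ?_⟩
  rw [hgρ]
  fin_cases i
  · simp [hx00, hy00]
  · simp [hy1]
  · simp only [Fin.reduceFinMk, Matrix.cons_val]
    field_simp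

lemma exists_mul_eq_rootVal_mul_at_infinity {ζ : K} (hζ : IsPrimitiveRoot ζ m) (h : m * n ∣ 24)
    (hx : IsWeberPoint r (m * n) x 0) (hy : IsWeberPoint r (m * n) y 0) (ht : t ≠ 0)
    (hxy : t • y ^ m = x ^ m) (hx0 : x ≠ 0) :
    ∃ g ∈ coverGroup m K, ∃ a : K, ∀ i, a * y i = rootVal (g i) * x i := by
  have hm : m ≠ 0 := by rintro rfl; simp at h
  obtain ⟨i, -, hi⟩ : ∃ i ∈ Finset.univ, x i = 0 := by
    rw [← Finset.prod_eq_zero_iff, hx.2, zero_pow three_ne_zero, mul_zero]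
  have hyi : y i = 0 := by
    have hi' : t * y i ^ m = x i ^ m := congrFun hxy i
    simpa [hi, hm, ht] using hi'
  let σ := Equiv.swap 0 i
  obtain ⟨g, hg, a, ha⟩ := exists_mul_eq_rootVal_mul_of_apply_zero_eq_zero hζ h
    (hx.comp_perm σ) (hy.comp_perm σ) (funext fun j => congrFun hxy (σ j))
    (fun hσ => hx0 (funext fun j => by simpa [σ] using congrFun hσ (σ j)))
    (by simp [σ, hi]) (by simp [σ, hyi])
  exact ⟨_, comp_perm_mem_coverGroup hg σ, a, fun j => by simpa [σ] using ha (σ j)⟩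

lemma exists_mul_eq_rootVal_mul_of_ne_zero [CharZero K] (hr : r ^ 2 = 2) {ζ : K}
    (hζ : IsPrimitiveRoot ζ m) (h : m * n ∣ 24) {d δ : K} (hd : d ≠ 0)
    (hx : IsWeberPoint r (m * n) x d) (hy : IsWeberPoint r (m * n) y δ)
    (hxy : t • y ^ m = x ^ m) (hdδ : t * δ ^ m = d ^ m)
    (hgen : 3 ∣ m → ¬ ∀ i j, x i ^ (m * n) = x j ^ (m * n)) :
    ∃ g ∈ coverGroup m K, ∃ a : K, (∀ i, a * y i = rootVal (g i) * x i) ∧ a * δ = d := by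
  have hm : m ≠ 0 := by rintro rfl; simp at h
  have hδ : δ ≠ 0 := by
    rintro rfl
    exact pow_ne_zero m hd (by rw [← hdδ, zero_pow hm, mul_zero])
  have had : d / δ * δ = d := div_mul_cancel₀ d hδ
  have ht : t = (d / δ) ^ m := by
    rw [div_pow, ← hdδ, mul_div_cancel_right₀ _ (pow_ne_zero m hδ)]
  have hay := hy.smul (d / δ)
  rw [had] at hay
  obtain ⟨g, hg, hgx⟩ := exists_mem_coverGroup_of_pow_eq hr hζ h hd hx hay (by
    rw [smul_pow, ← ht, hxy]) hgen
  exact ⟨g, hg, d / δ, hgx, had⟩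

lemma exists_mul_eq_rootVal_mul [CharZero K] (hr : r ^ 2 = 2) {ζ : K} (hζ : IsPrimitiveRoot ζ m)
    (h : m * n ∣ 24) {d δ : K} (hx : IsWeberPoint r (m * n) x d) (hy : IsWeberPoint r (m * n) y δ)
    (ht : t ≠ 0) (hxy : t • y ^ m = x ^ m) (hdδ : t * δ ^ m = d ^ m) (hxd : d = 0 → x ≠ 0)
    (hgen : d ≠ 0 → 3 ∣ m → ¬ ∀ i j, x i ^ (m * n) = x j ^ (m * n)) :
    ∃ g ∈ coverGroup m K, ∃ a : K, (∀ i, a * y i = rootVal (g i) * x i) ∧ a * δ = d := by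
  have hm : m ≠ 0 := by rintro rfl; simp at h
  rcases eq_or_ne d 0 with rfl | hd
  · obtain rfl : δ = 0 := by simpa [hm, ht] using hdδ
    obtain ⟨g, hg, a, ha⟩ := exists_mul_eq_rootVal_mul_at_infinity hζ h hx hy ht hxy (hxd rfl)
    exact ⟨g, hg, a, ha, mul_zero a⟩
  · exact exists_mul_eq_rootVal_mul_of_ne_zero hr hζ h hd hx hy hxy hdδ (hgen hd)

theorem exists_rootAct_eq [CharZero K] (hr : r ^ 2 = 2) {ζ : K} (hζ : IsPrimitiveRoot ζ m)
    (h : m * n ∣ 24) {P Q : ℙ K (Fin 4 → K)} (hP : P ∈ weberCurve r (m * n))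
    (hQ : Q ∈ weberCurve r (m * n)) (hPQ : powMap m P = powMap m Q)
    (hns : IsNonsingularAt r n (powMap m P)) : ∃ g ∈ coverGroup m K, rootAct g P = Q := by
  have hn : n ≠ 0 := by rintro rfl; simp at h
  induction P using Projectivization.ind with
  | h v hv =>
  induction Q using Projectivization.ind with
  | h w hw =>
    rw [mk_mem_weberCurve] at hP hQ
    have hvm : v ^ m ≠ 0 := pow_ne_zero m hv
    rw [powMap_mk m hv hvm, powMap_mk m hw (pow_ne_zero m hw),
      Projectivization.mk_eq_mk_iff'] at hPQ
    obtain ⟨t, hvw⟩ := hPQ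
    have ht : t ≠ 0 := by rintro rfl; exact hvm (by rw [← hvw, zero_smul])
    obtain ⟨g, hg, a, ha, ha₃⟩ := exists_mul_eq_rootVal_mul hr hζ h hP hQ ht
      (funext fun i => congrFun hvw i.castSucc) (congrFun hvw 3)
      (fun hv3 h0 => hv (funext (Fin.lastCases hv3 (congrFun h0))))
      fun hv3 h3 hpow => not_isNonsingularAt_mk hr hn (not_three_dvd_of_mul_dvd h h3) hvm
        (hP.pow hr h) (pow_ne_zero m hv3)
        (fun i j => by simpa only [Pi.pow_apply, Function.comp_apply, ← pow_mul] using hpow i j) hns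
    exact ⟨g, hg, rootAct_mk_eq_mk hv hw ha ha₃⟩

end ProjectiveFibres

end Weber

theorem mainTheorem7 {K : Type*} [Field K] [Algebra K ℂ]
    (r : K) (hr : r ^ 2 = 2) (hrpos : algebraMap K ℂ r = (Real.sqrt 2 : ℂ))
    (ζ : K) (hζ : IsPrimitiveRoot ζ 24)
    (m n : ℕ) (hmn : m * n ∣ 24) :
    -- the curves are integral, and the cover is dominant
    ∃ (_ : IsDomain (Weber.WeberRing r n)) (_ : IsDomain (Weber.WeberRing r (m * n)))
      (hinj : Function.Injective (Weber.pullback hr hmn).toRingHom)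
      (H : Subgroup (Fin 3 → rootsOfUnity m K)),
      -- the cover of projective curves, and `H` as a group of automorphisms of it
      Set.MapsTo (Weber.powMap m) (Weber.weberCurve r (m * n)) (Weber.weberCurve r n) ∧
      (IsAlgClosed K →
        Set.SurjOn (Weber.powMap m) (Weber.weberCurve r (m * n)) (Weber.weberCurve r n)) ∧
      (∀ h ∈ H, ∀ P ∈ Weber.weberCurve r (m * n),
        Weber.rootAct h P ∈ Weber.weberCurve r (m * n) ∧
        Weber.powMap m (Weber.rootAct h P) = Weber.powMap m P) ∧
      -- the fibres over nonsingular points of `W_n` are `H`-orbits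
      (∀ P ∈ Weber.weberCurve r (m * n), ∀ Q ∈ Weber.weberCurve r (m * n),
        Weber.powMap m P = Weber.powMap m Q → Weber.IsNonsingularAt r n (Weber.powMap m P) →
        ∃ h ∈ H, Weber.rootAct h P = Q) ∧
      -- the cover is Galois, its automorphism group is `H` acting by scaling the coordinates,
      -- and `K(W_n)` is the field of `H`-invariants in `K(W_{mn})`
      IsGalois (Weber.pullbackField hr hmn hinj) (Weber.WeberField r (m * n)) ∧
      (∃ e : H ≃* (Weber.WeberField r (m * n) ≃ₐ[Weber.pullbackField hr hmn hinj]
            Weber.WeberField r (m * n)),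
        (∀ (h : H) (i : Fin 3),
          e h (Weber.coordFun r (m * n) i) =
            ((h.1 i : Kˣ) : K) • Weber.coordFun r (m * n) i) ∧
        (∀ f : Weber.WeberField r (m * n),
          f ∈ Weber.pullbackField hr hmn hinj ↔ ∀ h : H, e h f = f)) ∧
      -- `H` is isomorphic to `Γ_n / Γ_{mn}`, through the action on the Weber functions
      Weber.weberGamma (m * n) ≤ Weber.weberGamma n ∧
      (∃ (_ : ((Weber.weberGamma (m * n)).subgroupOf (Weber.weberGamma n)).Normal)
          (θ : (Weber.weberGamma n ⧸
            (Weber.weberGamma (m * n)).subgroupOf (Weber.weberGamma n)) ≃* H),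
        ∀ (γ : Matrix.SpecialLinearGroup (Fin 2) ℤ)
          (hγ : (QuotientGroup.mk γ : Matrix.ProjectiveSpecialLinearGroup (Fin 2) ℤ) ∈
            Weber.weberGamma n) (i : Fin 3) (τ : UpperHalfPlane),
          Weber.weberU i (γ • τ) ^ (24 / (m * n)) =
            algebraMap K ℂ (((θ (QuotientGroup.mk ⟨QuotientGroup.mk γ, hγ⟩)).1 i : Kˣ) : K) *
              Weber.weberU i τ ^ (24 / (m * n))) ∧
      -- identification of `H`, and the degree of the cover
      (m = 3 → H = Weber.diagonalGroup m K) ∧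
      (m ∣ 8 → H = Weber.antidiagonalGroup m K) ∧
      (m = 3 →
        Module.finrank (Weber.pullbackField hr hmn hinj) (Weber.WeberField r (m * n)) = 3) ∧
      (m ∣ 8 →
        Module.finrank (Weber.pullbackField hr hmn hinj) (Weber.WeberField r (m * n)) = m ^ 2) := by
  have : CharZero K := (algebraMap K ℂ).charZero
  have hω : IsPrimitiveRoot (ζ ^ 8) 3 := hζ.pow (by norm_num) (by norm_num)
  have hm : m ∣ 24 := (Dvd.intro n rfl).trans hmn
  have hζm : IsPrimitiveRoot (ζ ^ (24 / m)) m :=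
    hζ.pow (by norm_num) (Nat.div_mul_cancel hm).symm
  have := Weber.isDomain_weberRing hr hω ((Dvd.intro_left m rfl).trans hmn)
  have := Weber.isDomain_weberRing hr hω hmn
  have hinj := Weber.pullback_injective hr hω hmn
  have hdeg := Weber.finrank_pullbackField hr hmn hinj hζm
  refine ⟨inferInstance, inferInstance, hinj, Weber.coverGroup m K, Weber.mapsTo_powMap hr hmn,
    fun _ => Weber.surjOn_powMap hr hmn,
    fun _ hh _ hP => Weber.rootAct_mem_and_powMap_rootAct hmn hh hP,
    fun _ hP _ hQ => Weber.exists_rootAct_eq hr hζm hmn hP hQ,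
    Weber.isGalois_pullbackField hr hmn hinj hζm,
    ⟨Weber.galoisEquiv hr hmn hinj hζm, Weber.galoisHom_coordFun hr hmn hinj,
      Weber.mem_pullbackField_iff hr hmn hinj hζm⟩,
    Weber.weberGamma_le hmn, Weber.exists_quotient_weberGamma_mulEquiv hζ hmn, ?_,
    Weber.coverGroup_of_dvd_eight, ?_, fun h8 =>
      hdeg.trans (Weber.card_coverGroup_of_dvd_eight hζm h8)⟩
  · rintro rfl
    exact Weber.coverGroup_three
  · rintro rfl
    exact hdeg.trans (Weber.card_coverGroup_three hζm)
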